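/- **Setting.** Agents $1,\dots,n$ communicate over a connected undirected graph $\mathcal G$; $\mathcal N\subseteq[n]$ is the set of unattacked agents, $\mathcal A=[n]\setminus\mathcal N$ the set of attacked ones, $\rho=|\mathcal A|/n$, and $f=\frac1{|\mathcal N|}\sum_{i\in\mathcal N}f_i$ with $f_i:\mathbb R^d\to\mathbb R$. Assume: * for every $i\in\mathcal N$, $f_i$ is convex, twice differentiable and $L$-smooth ($\|\nabla f_i(x)-\nabla f_i(y)\|\le L\|x-y\|$); $f$ is $\mu$-strongly convex, $\mu>0$; and a point $x^*$ minimizes every $f_i$, $i\in\mathcal N$; * $\rho<1/(1+\kappa)$, where $\kappa=L/\mu$; * $W=(w_{ij})$ is nonnegative, symmetric and doubly stochastic, $w_{ij}\ne0$ only if $i=j$ or $i,j$ are adjacent in $\mathcal G$, and its eigenvalues, with multiplicity, satisfy $1=\lambda_1>|\lambda_2|\ge\dots\ge|\lambda_n|$; * at time $t$ the gradient oracle of agent $i$ returns $m_i^t$; for $i\in\mathcal N$, $m_i^t=\nabla f_i(x_i^t)+\xi_i^t$, where the noises $\xi_i^t$ ($i\in\mathcal N$, $t\ge0$) are mutually independent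 with $\mathbb E\,\xi_i^t=0$ and $\mathbb E\|\xi_i^t\|^2\le\sigma^2$; for $i\in\mathcal A$, $m_i^t$ is arbitrary. **Algorithm (CLIP-VRG).** From a common starting point $x_1^0=\dots=x_n^0$, every agent $i\in[n]$ sets $v_i^0=m_i^0$ and, for $t\ge0$, $$v_i^{t+1}=(1-\eta_t)v_i^t+\eta_t m_i^{t+1},\qquad x_i^{t+1}=\sum_{j=1}^n w_{ij}\bigl(x_j^t-\alpha_t k_j^t v_j^t\bigr),$$ where $k_j^t=1$ if $\|v_j^t\|\le\gamma_t$ and $k_j^t=\gamma_t/\|v_j^t\|$ otherwise, and $$\alpha_t=c_\alpha(t+\varphi)^{-\tau_\alpha},\quad \gamma_t=c_\gamma(t+\varphi)^{-\tau_\gamma},\quad \eta_t=c_\eta(t+\varphi)^{-\tau_\eta}$$ all take values in $(0,1)$, with $c_\alpha,c_\gamma,c_\eta>0$ and an integer $\varphi\ge1$. **Statement.** Say that exponents $(\tau_\alpha,\tau_\gamma,\tau_\eta)$ *achieve the rate* if, for every such problem and every such choice of $c_\alpha,c_\gamma,c_\eta,\varphi$, for every agent $i\in[n]$ and every $0<\epsilon<1/3$,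 $$\lim_{t\to\infty}(t+1)^{1/3-\epsilon}\bigl(f(x_i^t)-f(x^*)\bigr)=0\quad\text{almost surely.}$$ 1. There are exponents with $\tau_\gamma>0$, $2\tau_\gamma<\tau_\alpha<\min(1,1-\tau_\gamma)$ and $\tau_\eta=2(\tau_\alpha+\tau_\gamma)/3$ that achieve the rate. 2. The exponents $\tau_\alpha=5/6$, $\tau_\gamma=1/6$, $\tau_\eta=2/3$ achieve the rate. 3. The pair $(\tau_\alpha,\tau_\gamma)=(5/6,1/6)$ is the unique maximizer of $\min\bigl(\tau_\gamma,(\tau_\alpha-2\tau_\gamma)/3\bigr)$ subject to $2\tau_\gamma\le\tau_\alpha\le\min(1,1-\tau_\gamma)$; the maximum is $1/6$. -/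

import Mathlib

open MeasureTheory ProbabilityTheory Filter Topology

universe u

noncomputable section

namespace ClipVRG

/-- The objective `f = (1 / |N|) ∑_{i ∈ N} f_i`, averaged over the set `N` of unattacked agents. -/
def avgObjective {n d : ℕ} (f : Fin n → EuclideanSpace ℝ (Fin d) → ℝ) (N : Finset (Fin n))
    (x : EuclideanSpace ℝ (Fin d)) : ℝ :=
  (1 / (N.card : ℝ)) * ∑ i ∈ N, f i x

/-- Assumptions on the objectives: every unattacked `f_i` is convex, twice differentiable and
`L`-smooth, the average `f` over the unattacked agents is `μ`-strongly convex, and `xstar`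
minimizes every unattacked `f_i`. -/
structure ObjectiveAssumptions {n d : ℕ} (f : Fin n → EuclideanSpace ℝ (Fin d) → ℝ)
    (N : Finset (Fin n)) (L μ : ℝ) (xstar : EuclideanSpace ℝ (Fin d)) : Prop where
  L_pos : 0 < L
  μ_pos : 0 < μ
  differentiable : ∀ i ∈ N, Differentiable ℝ (f i)
  differentiable_gradient : ∀ i ∈ N, Differentiable ℝ (gradient (f i))
  smooth : ∀ i ∈ N, ∀ x y, ‖gradient (f i) x - gradient (f i) y‖ ≤ L * ‖x - y‖
  convex : ∀ i ∈ N, ConvexOn ℝ Set.univ (f i)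
  strongly_convex : ∀ x y, avgObjective f N y ≥
    avgObjective f N x + inner ℝ (gradient (avgObjective f N) x) (y - x) + μ / 2 * ‖y - x‖ ^ 2
  common_minimizer : ∀ i ∈ N, ∀ x, f i xstar ≤ f i x

/-- Assumptions on the communication graph `G` (undirected, connected) and the mixing matrix `W`
(nonnegative, supported on the edges and the diagonal, symmetric, doubly stochastic; counted with
multiplicity, one eigenvalue is `1` and all the others have absolute value `< 1`). -/
structure NetworkAssumptions {n : ℕ} (G : SimpleGraph (Fin n)) (W : Matrix (Fin n) (Fin n) ℝ) :
    Prop where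
  connected : G.Connected
  nonneg : ∀ i j, 0 ≤ W i j
  support : ∀ i j, W i j ≠ 0 → G.Adj i j ∨ i = j
  symm : W.IsHermitian
  row_sum : ∀ i, ∑ j, W i j = 1
  col_sum : ∀ j, ∑ i, W i j = 1
  spectral_gap : ∃ i₀, symm.eigenvalues i₀ = 1 ∧ ∀ j, j ≠ i₀ → |symm.eigenvalues j| < 1

/-- Assumptions on the gradient noise of the unattacked agents: mutual independence over all
unattacked agents and all times, zero mean, second moment at most `σ ^ 2`. -/
structure NoiseAssumptions {n d : ℕ} {Ω : Type u} [MeasurableSpace Ω] (P : Measure Ω)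
    (N : Finset (Fin n)) (ξ : Fin n → ℕ → Ω → EuclideanSpace ℝ (Fin d)) (σ : ℝ) : Prop where
  measurable : ∀ i ∈ N, ∀ t, Measurable (ξ i t)
  independent : iIndepFun (fun p : {i // i ∈ N} × ℕ => ξ p.1.1 p.2) P
  memLp_two : ∀ i ∈ N, ∀ t, MemLp (ξ i t) 2 P
  mean_zero : ∀ i ∈ N, ∀ t, ∫ ω, ξ i t ω ∂P = 0
  second_moment : ∀ i ∈ N, ∀ t, ∫ ω, ‖ξ i t ω‖ ^ 2 ∂P ≤ σ ^ 2

/-- The sequence `c (t + φ)^(-τ)`. -/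
def powerSeq (c : ℝ) (φ : ℕ) (τ : ℝ) (t : ℕ) : ℝ := c * ((t : ℝ) + (φ : ℝ)) ^ (-τ)

/-- Admissible parameters of such a sequence: `c > 0`, and all values lie in `(0, 1)`. -/
def PowerSeqOK (c : ℝ) (φ : ℕ) (τ : ℝ) : Prop :=
  0 < c ∧ ∀ t, powerSeq c φ τ t ∈ Set.Ioo (0 : ℝ) 1

/-- The clipping coefficient: `1` if `‖v‖ ≤ γ`, and `γ / ‖v‖` otherwise. -/
def clipCoeff {d : ℕ} (γ : ℝ) (v : EuclideanSpace ℝ (Fin d)) : ℝ :=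
  if ‖v‖ ≤ γ then 1 else γ * ‖v‖⁻¹

/-- One sample path of the algorithm, with iterates `x i t`, gradient estimators `v i t` and oracle
outputs `m i t`. For `i ∈ N` the oracle returns the gradient plus the noise `ξ i t`; for `i ∉ N`
(the attacked agents) nothing at all is required of `m i t`. -/
structure IsPath {n d : ℕ} (f : Fin n → EuclideanSpace ℝ (Fin d) → ℝ) (N : Finset (Fin n))
    (W : Matrix (Fin n) (Fin n) ℝ) (α γ η : ℕ → ℝ)
    (ξ x v m : Fin n → ℕ → EuclideanSpace ℝ (Fin d)) : Prop where
  oracle : ∀ i ∈ N, ∀ t, m i t = gradient (f i) (x i t) + ξ i t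
  init_x : ∀ i j, x i 0 = x j 0
  init_v : ∀ i, v i 0 = m i 0
  step_v : ∀ i t, v i (t + 1) = (1 - η t) • v i t + η t • m i (t + 1)
  step_x : ∀ i t, x i (t + 1) =
    ∑ j, W i j • (x j t - α t • (clipCoeff (γ t) (v j t) • v j t))

/-- With the exponents `τα, τγ, τη`, the algorithm has the almost sure rate
`(t + 1)^(1/3 - ε) (f(x_i^t) - f(x^*)) → 0` for every agent `i` (attacked or not) and every
`0 < ε < 1/3`, on every problem that satisfies the assumptions, with a fraction of attacked agents
below `1 / (1 + L / μ)`, for every admissible choice of the remaining algorithm constants. -/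
def AchievesRate (τα τγ τη : ℝ) : Prop :=
  ∀ (n d : ℕ) (f : Fin n → EuclideanSpace ℝ (Fin d) → ℝ) (N : Finset (Fin n)) (L μ : ℝ)
    (xstar : EuclideanSpace ℝ (Fin d)) (G : SimpleGraph (Fin n)) (W : Matrix (Fin n) (Fin n) ℝ)
    (Ω : Type u) [MeasurableSpace Ω] (P : Measure Ω) [IsProbabilityMeasure P]
    (ξ : Fin n → ℕ → Ω → EuclideanSpace ℝ (Fin d)) (σ : ℝ)
    (cα cγ cη : ℝ) (φ : ℕ) (x v m : Fin n → ℕ → Ω → EuclideanSpace ℝ (Fin d)),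
    ObjectiveAssumptions f N L μ xstar →
    NetworkAssumptions G W →
    ((Nᶜ.card : ℝ) / (n : ℝ) < 1 / (1 + L / μ)) →
    NoiseAssumptions P N ξ σ →
    0 < φ → PowerSeqOK cα φ τα → PowerSeqOK cγ φ τγ → PowerSeqOK cη φ τη →
    (∀ᵐ ω ∂P, IsPath f N W (powerSeq cα φ τα) (powerSeq cγ φ τγ) (powerSeq cη φ τη)
      (fun i t => ξ i t ω) (fun i t => x i t ω) (fun i t => v i t ω) (fun i t => m i t ω)) →
    ∀ (i : Fin n) (ε : ℝ), 0 < ε → ε < 1 / 3 →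
      ∀ᵐ ω ∂P, Tendsto
        (fun t : ℕ => ((t : ℝ) + 1) ^ (1 / 3 - ε) *
          (avgObjective f N (x i t ω) - avgObjective f N xstar)) atTop (𝓝 0)

end ClipVRG

end

/-! Let `D` be the distance from the network average to the minimizer. The core is that almost
surely `D = O(γ)`. The disagreement between agents is `O(α γ)`, so every agent is then at distance
`O(γ)`, and smoothness makes the objective gap `O(γ ^ 2)`, which is of order `t ^ (-1/3)` for `τγ =
1/6`.

Suppose `γ ≤ L D`. Unattacked gradients have norm at most `L D`, so clipping keeps at least the
fraction `γ / (L D)` of each, and strong convexity yields a total pull of at least `|N| (μ / L) γ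
D`. The attacked agents, being clipped, push back by at most `|Nᶜ| γ D`. The bound on the attacked
fraction makes the difference positive (`sum_inner_clip_ge`, `drift_pos_of_fraction_lt`), so `D`
drifts down at rate `α γ`. This is not summable when `τα + τγ ≤ 1`, boundary included.

The estimator error `S` need not be small compared with `γ` at each time. Young's inequality turns
its effect into `(α / γ) S ^ 2` (`le_of_sq_le_drift`), and such terms are harmless once summable
after division by `γ` (`exists_bound_of_drift_error`). Here `S ^ 2` consists of averaged noise with
second moment `O(η)`, a tracking error `(α γ / η) ^ 2`, which is `O(η)` if `3 τη ≤ 2 (τα + τγ)`, and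
a smaller consensus term. All that remains is `∑ α η / γ ^ 2 < ∞`, that is `τα - 2 τγ + τη > 1`;
this leaves room around the stated exponents. -/

noncomputable section

namespace ClipVRG

/-! ### Arithmetic and decay of power sequences. -/

section PowerSeq

variable {c c' : ℝ} {φ : ℕ} {τ τ' : ℝ}

lemma base_pos (hφ : 0 < φ) (t : ℕ) : 0 < (t : ℝ) + (φ : ℝ) := by
  have : (0 : ℝ) < φ := by exact_mod_cast hφ
  positivity

lemma powerSeq_pos (hc : 0 < c) (hφ : 0 < φ) (t : ℕ) : 0 < powerSeq c φ τ t :=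
  mul_pos hc (Real.rpow_pos_of_pos (base_pos hφ t) _)

lemma powerSeq_mul (hφ : 0 < φ) (t : ℕ) :
    powerSeq c φ τ t * powerSeq c' φ τ' t = powerSeq (c * c') φ (τ + τ') t := by
  unfold powerSeq
  rw [neg_add, Real.rpow_add (base_pos hφ t)]
  ring

lemma powerSeq_inv (hφ : 0 < φ) (t : ℕ) :
    (powerSeq c φ τ t)⁻¹ = powerSeq c⁻¹ φ (-τ) t := by
  unfold powerSeq
  rw [mul_inv, ← Real.rpow_neg (base_pos hφ t).le]

lemma powerSeq_div (hφ : 0 < φ) (t : ℕ) :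
    powerSeq c φ τ t / powerSeq c' φ τ' t = powerSeq (c / c') φ (τ - τ') t := by
  rw [div_eq_mul_inv, powerSeq_inv hφ, powerSeq_mul hφ, div_eq_mul_inv, sub_eq_add_neg]

lemma powerSeq_anti (hc : 0 < c) (hφ : 0 < φ) (hτ : 0 ≤ τ) : Antitone (powerSeq c φ τ) := by
  intro s t hst
  have h : (s : ℝ) ≤ t := by exact_mod_cast hst
  exact mul_le_mul_of_nonneg_left
    (Real.rpow_le_rpow_of_nonpos (base_pos hφ s) (by linarith) (by linarith)) hc.le

lemma powerSeq_le_of_le (hc : 0 ≤ c) (hφ : 0 < φ) (h : τ ≤ τ') (t : ℕ) :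
    powerSeq c φ τ' t ≤ powerSeq c φ τ t := by
  have h1 : (1 : ℝ) ≤ φ := by exact_mod_cast hφ
  have h2 : (0 : ℝ) ≤ t := t.cast_nonneg
  exact mul_le_mul_of_nonneg_left
    (Real.rpow_le_rpow_of_exponent_le (by linarith) (by linarith)) hc

lemma tendsto_powerSeq (hτ : 0 < τ) : Tendsto (powerSeq c φ τ) atTop (𝓝 0) := by
  have h1 : Tendsto (fun t : ℕ => (t : ℝ) + (φ : ℝ)) atTop atTop :=
    tendsto_atTop_add_const_right _ _ tendsto_natCast_atTop_atTop
  have h2 := ((tendsto_rpow_neg_atTop hτ).comp h1).const_mul c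
  rw [mul_zero] at h2
  exact h2

lemma summable_powerSeq_iff (hc : 0 < c) (hφ : 0 < φ) : Summable (powerSeq c φ τ) ↔ 1 < τ := by
  rw [← Real.summable_one_div_nat_add_rpow (φ : ℝ) τ]
  unfold powerSeq
  rw [summable_mul_left_iff hc.ne']
  refine summable_congr fun t => ?_
  rw [abs_of_pos (base_pos hφ t), Real.rpow_neg (base_pos hφ t).le, one_div]

/-- Bernoulli's inequality `(1 + 1/z) ^ (-τ) ≥ 1 - τ/z` at `z = t + φ`, obtained from `log u ≤ u -
1` and `exp u ≥ 1 + u`. -/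
lemma powerSeq_succ_ge (hc : 0 < c) (hφ : 0 < φ) (hτ : 0 ≤ τ) (t : ℕ) :
    (1 - powerSeq τ φ 1 t) * powerSeq c φ τ t ≤ powerSeq c φ τ (t + 1) := by
  have hz := base_pos hφ t
  set z : ℝ := (t : ℝ) + φ with hzdef
  have e1 : powerSeq c φ τ (t + 1) = c * ((z * (1 + 1 / z)) ^ (-τ)) := by
    unfold powerSeq
    congr 2
    rw [mul_add, mul_one_div_cancel hz.ne']
    push_cast
    ring
  have e2 : powerSeq c φ τ t = c * z ^ (-τ) := rfl
  have e3 : powerSeq τ φ 1 t = τ * (1 / z) := by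
    simp only [powerSeq]
    rw [← hzdef, Real.rpow_neg hz.le, Real.rpow_one, one_div]
  rw [e1, e2, e3, Real.mul_rpow hz.le (by positivity)]
  have h0 : (0 : ℝ) < 1 + 1 / z := by positivity
  have h1 : 1 - τ * (1 / z) ≤ (1 + 1 / z) ^ (-τ) := by
    have : Real.log (1 + 1 / z) ≤ 1 / z := by
      have := Real.log_le_sub_one_of_pos h0
      linarith
    rw [Real.rpow_def_of_pos h0]
    have h2 := Real.add_one_le_exp (Real.log (1 + 1 / z) * -τ)
    nlinarith [mul_le_mul_of_nonneg_left this hτ]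
  have h2 : 0 < c * z ^ (-τ) := mul_pos hc (Real.rpow_pos_of_pos hz _)
  nlinarith [mul_le_mul_of_nonneg_right h1 h2.le]

lemma eventually_powerSeq_le (hc' : 0 < c') (hφ : 0 < φ) (h : τ' < τ) :
    ∀ᶠ t in atTop, powerSeq c φ τ t ≤ powerSeq c' φ τ' t := by
  have h1 : Tendsto (powerSeq (c / c') φ (τ - τ')) atTop (𝓝 0) := tendsto_powerSeq (by linarith)
  filter_upwards [h1.eventually_lt_const one_pos] with t ht
  rw [← powerSeq_div hφ, div_lt_one (powerSeq_pos hc' hφ t)] at ht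
  exact ht.le

/-- A power sequence decays slowly relative to any power sequence with exponent below `1`. -/
lemma eventually_powerSeq_slow (hc : 0 < c) (hc' : 0 < c') (hφ : 0 < φ) (hτ : 0 ≤ τ)
    (hτ' : τ' < 1) :
    ∀ᶠ t in atTop, (1 - powerSeq c' φ τ' t) * powerSeq c φ τ t ≤ powerSeq c φ τ (t + 1) := by
  filter_upwards [eventually_powerSeq_le (c := τ) hc' hφ hτ'] with t ht
  refine le_trans ?_ (powerSeq_succ_ge hc hφ hτ t)
  exact mul_le_mul_of_nonneg_right (by linarith) (powerSeq_pos hc hφ t).le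

lemma powerSeq_const_mul (k : ℝ) (t : ℕ) : k * powerSeq c φ τ t = powerSeq (k * c) φ τ t := by
  unfold powerSeq
  ring

end PowerSeq

/-! ### Deterministic recursions. -/

/-- A perturbed contraction follows its slowly varying perturbation. -/
lemma exists_bound_of_contraction {s a b : ℕ → ℝ} {K : ℝ} (hb : ∀ t, 0 < b t)
    (ha : ∀ t, 0 ≤ a t ∧ a t ≤ 1) (hK : 0 ≤ K)
    (hs : ∀ t, s (t + 1) ≤ (1 - a t) * s t + K * a t * b t)
    (hslow : ∀ᶠ t in atTop, (1 - a t / 2) * b t ≤ b (t + 1)) :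
    ∃ C, 0 ≤ C ∧ ∀ t, s t ≤ C * b t := by
  obtain ⟨T, hT⟩ := eventually_atTop.1 hslow
  have hq : ∀ t, 0 ≤ |s t| / b t := fun t => div_nonneg (abs_nonneg _) (hb t).le
  have hS : 0 ≤ ∑ t ∈ Finset.range (T + 1), |s t| / b t := Finset.sum_nonneg fun t _ => hq t
  -- With a constant of at least `2 * K`, half of the contraction absorbs the perturbation and the
  -- other half the decay of `b`. The sum covers the times before `hslow` takes effect.
  refine ⟨2 * K + ∑ t ∈ Finset.range (T + 1), |s t| / b t, by positivity, ?_⟩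
  set S := ∑ t ∈ Finset.range (T + 1), |s t| / b t with hSdef
  have small : ∀ t ≤ T, s t ≤ (2 * K + S) * b t := by
    intro t ht
    have h1 : |s t| / b t ≤ S :=
      Finset.single_le_sum (f := fun t => |s t| / b t) (fun t _ => hq t)
        (Finset.mem_range.2 (by omega))
    have h2 : |s t| ≤ S * b t := (div_le_iff₀ (hb t)).1 h1
    nlinarith [le_abs_self (s t), mul_nonneg hK (hb t).le]
  intro t
  rcases le_total t T with h | h
  · exact small t h
  · induction t, h using Nat.le_induction with
    | base => exact small T le_rfl
    | succ t ht ih =>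
      have h1 := mul_le_mul_of_nonneg_left ih (sub_nonneg.2 (ha t).2)
      have h2 := mul_le_mul_of_nonneg_left (hT t ht) (by positivity : 0 ≤ 2 * K + S)
      have h3 : 0 ≤ S * (a t * b t) := mul_nonneg hS (mul_nonneg (ha t).1 (hb t).le)
      nlinarith [hs t]

/-- A nonnegative sequence with non-summable downward drift reaches a slowly varying level and
stays below a multiple of it. -/
lemma exists_bound_of_drift {Z a g : ℕ → ℝ} {K : ℝ} (hZ : ∀ t, 0 ≤ Z t)
    (ha : ∀ t, 0 ≤ a t) (hK : 0 ≤ K)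
    (hstep : ∀ᶠ t in atTop, Z (t + 1) ≤ max (Z t - a t) (K * g t))
    (hg2 : ∀ᶠ t in atTop, g t ≤ 2 * g (t + 1))
    (hslow : ∀ C, ∀ᶠ t in atTop, C * (g t - g (t + 1)) ≤ a t) (hdiv : ¬ Summable a) :
    ∀ᶠ t in atTop, Z t ≤ 2 * K * g t := by
  obtain ⟨T, hT⟩ := eventually_atTop.1 (hstep.and (hg2.and (hslow (2 * K))))
  have low : ∀ t ≥ T, K * g t ≤ 2 * K * g (t + 1) := fun t ht => by
    nlinarith [mul_le_mul_of_nonneg_left (hT t ht).2.1 hK]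
  have stay : ∀ t ≥ T, Z t ≤ 2 * K * g t → Z (t + 1) ≤ 2 * K * g (t + 1) := by
    intro t ht hz
    refine (hT t ht).1.trans (max_le ?_ (low t ht))
    linarith [(hT t ht).2.2]
  obtain ⟨t₀, ht₀, hz₀⟩ : ∃ t ≥ T, Z t ≤ 2 * K * g t := by
    -- If the level were never reached, every step would descend by `a`, and nonnegativity of `Z`
    -- would make `a` summable.
    by_contra! hcon
    have dec : ∀ t ≥ T, Z (t + 1) ≤ Z t - a t := by
      intro t ht
      rcases le_max_iff.1 (hT t ht).1 with h | h
      · exact h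
      · exact absurd (h.trans (low t ht)) (not_le.2 (hcon (t + 1) (by omega)))
    have tele : ∀ k, ∑ j ∈ Finset.range k, a (j + T) ≤ Z T - Z (k + T) := by
      intro k
      induction k with
      | zero => simp
      | succ k ih =>
        rw [Finset.sum_range_succ]
        have := dec (k + T) (by omega)
        rw [show k + 1 + T = k + T + 1 by ring]
        linarith
    refine hdiv ((summable_nat_add_iff T).1 ?_)
    exact summable_of_sum_range_le (fun _ => ha _) fun k => (tele k).trans
      (by linarith [hZ (k + T)] : _ ≤ Z T)
  filter_upwards [eventually_ge_atTop t₀] with t ht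
  induction t, ht using Nat.le_induction with
  | base => exact hz₀
  | succ t ht ih => exact stay t (ht₀.trans ht) ih

/-- The conclusion of `exists_bound_of_drift` survives errors that are summable relative to the
level. -/
lemma exists_bound_of_drift_error {D a h g : ℕ → ℝ} {K K' : ℝ} (hg : ∀ t, 0 < g t)
    (hanti : Antitone g) (hD : ∀ t, 0 ≤ D t) (ha : ∀ t, 0 ≤ a t) (hK : 0 ≤ K)
    (hh : ∀ t, 0 ≤ h t) (hsum : Summable fun t => h t / g t)
    (hfar : ∀ᶠ t in atTop, K' * g t ≤ D t → D (t + 1) ≤ D t - a t + h t)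
    (hnear : ∀ᶠ t in atTop, D t ≤ K' * g t → D (t + 1) ≤ K * g t)
    (hg2 : ∀ᶠ t in atTop, g t ≤ 2 * g (t + 1))
    (hslow : ∀ C, ∀ᶠ t in atTop, C * (g t - g (t + 1)) ≤ a t) (hdiv : ¬ Summable a) :
    ∃ C, ∀ᶠ t in atTop, D t ≤ C * g t := by
  have hle : ∀ s t, s ≤ t → h t ≤ g s * (h t / g t) := by
    intro s t hst
    rw [mul_div_assoc', le_div_iff₀ (hg t), mul_comm]
    exact mul_le_mul_of_nonneg_right (hanti hst) (hh t)
  have hs : Summable h := Summable.of_nonneg_of_le hh (fun t => hle 0 t (Nat.zero_le t))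
    (hsum.mul_left (g 0))
  have hst : ∀ t, Summable fun j => h (j + t) := fun t => (summable_nat_add_iff t).2 hs
  have hsgt : ∀ t, Summable fun j => h (j + t) / g (j + t) := fun t =>
    (summable_nat_add_iff t).2 hsum
  have hq : ∀ t, 0 ≤ h t / g t := fun t => div_nonneg (hh t) (hg t).le
  set R := ∑' t, h t / g t with hR
  have hR0 : 0 ≤ R := tsum_nonneg hq
  have tail0 : ∀ t, 0 ≤ ∑' j, h (j + t) := fun t => tsum_nonneg fun _ => hh _
  have tail_succ : ∀ t, ∑' j, h (j + t) = h t + ∑' j, h (j + (t + 1)) := by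
    intro t
    rw [(hst t).tsum_eq_zero_add]
    simp only [zero_add]
    congr 1
    exact tsum_congr fun j => by congr 1; ring
  have tail_le : ∀ t, ∑' j, h (j + t) ≤ R * g t := by
    intro t
    calc ∑' j, h (j + t) ≤ ∑' j, g t * (h (j + t) / g (j + t)) :=
          (hst t).tsum_le_tsum (fun j => hle _ _ (by omega)) ((hsgt t).mul_left _)
      _ = g t * ∑' j, h (j + t) / g (j + t) := tsum_mul_left
      _ ≤ g t * R := by
          refine mul_le_mul_of_nonneg_left ?_ (hg t).le
          rw [hR, ← hsum.sum_add_tsum_nat_add t]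
          linarith [Finset.sum_nonneg fun j (_ : j ∈ Finset.range t) => hq j]
      _ = R * g t := mul_comm _ _
  -- Adding the tail of the future errors to `D` cancels the error of each step; the tail itself is
  -- at most `R * g t` because `g` is antitone.
  have key := exists_bound_of_drift (Z := fun t => D t + ∑' j, h (j + t)) (a := a) (g := g)
    (K := K + R) (fun t => add_nonneg (hD t) (tail0 t)) ha (by positivity) ?_ hg2 hslow hdiv
  · refine ⟨2 * (K + R), ?_⟩
    filter_upwards [key] with t ht
    linarith [tail0 t]
  · filter_upwards [hfar, hnear] with t h1 h2
    rw [le_max_iff]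
    rcases le_total (K' * g t) (D t) with hc | hc
    · left
      linarith [h1 hc, tail_succ t]
    · right
      nlinarith [h2 hc, tail_le t, tail_succ t, hh t]

/-! ### Clipping. -/

section Clip

variable {d : ℕ} {γ : ℝ} {v w : EuclideanSpace ℝ (Fin d)}

lemma clipCoeff_nonneg (hγ : 0 < γ) : 0 ≤ clipCoeff γ v := by
  unfold clipCoeff
  split_ifs <;> positivity

lemma norm_clip_le (hγ : 0 < γ) : ‖clipCoeff γ v • v‖ ≤ γ := by
  rw [norm_smul, Real.norm_of_nonneg (clipCoeff_nonneg hγ)]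
  unfold clipCoeff
  split_ifs with h
  · simpa using h
  · rw [mul_assoc, inv_mul_cancel₀ (by linarith), mul_one]

lemma le_clipCoeff {M : ℝ} (hγ : 0 < γ) (hM : γ ≤ M) (hv : ‖v‖ ≤ M) :
    γ / M ≤ clipCoeff γ v := by
  have hM0 : 0 < M := hγ.trans_le hM
  unfold clipCoeff
  split_ifs with h
  · exact (div_le_one hM0).2 hM
  · rw [← div_eq_mul_inv]
    exact div_le_div_of_nonneg_left hγ.le (by linarith) hv

lemma clipCoeff_le_one (hγ : 0 < γ) : clipCoeff γ v ≤ 1 := by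
  unfold clipCoeff
  split_ifs with h
  · exact le_rfl
  · rw [← div_eq_mul_inv]
    exact (div_le_one (by linarith)).2 (by linarith)

/-- The coefficient alone has Lipschitz constant of order `1 / γ`; the weight `‖w‖` removes this
dependence, which matters because `γ` tends to zero. -/
lemma abs_clipCoeff_sub_mul_le (hγ : 0 < γ) :
    |clipCoeff γ v - clipCoeff γ w| * ‖w‖ ≤ ‖v - w‖ := by
  have h1 : ‖v‖ - ‖w‖ ≤ ‖v - w‖ := norm_sub_norm_le v w
  have h2 : ‖w‖ - ‖v‖ ≤ ‖v - w‖ := by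
    rw [norm_sub_rev]
    exact norm_sub_norm_le w v
  have hw := norm_nonneg w
  have main : |(clipCoeff γ v - clipCoeff γ w) * ‖w‖| ≤ ‖v - w‖ := by
    unfold clipCoeff
    split_ifs with hv hw' hw'
    · simp
    · have : (1 - γ * ‖w‖⁻¹) * ‖w‖ = ‖w‖ - γ := by
        have : ‖w‖ ≠ 0 := by linarith
        field_simp
      rw [this, abs_le]
      constructor <;> linarith
    · have hv0 : 0 < ‖v‖ := by linarith
      have e : (γ * ‖v‖⁻¹ - 1) * ‖w‖ = -((‖v‖ - γ) * (‖w‖ / ‖v‖)) := by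
        field_simp
        ring
      have h3 : ‖w‖ / ‖v‖ ≤ 1 := (div_le_one hv0).2 (by linarith)
      have h4 : 0 ≤ ‖w‖ / ‖v‖ := by positivity
      rw [e, abs_neg, abs_of_nonneg (mul_nonneg (by linarith) h4)]
      nlinarith
    · have hv0 : 0 < ‖v‖ := by linarith
      have hw0 : 0 < ‖w‖ := by linarith
      have e : (γ * ‖v‖⁻¹ - γ * ‖w‖⁻¹) * ‖w‖ = γ / ‖v‖ * (‖w‖ - ‖v‖) := by
        field_simp
      have h3 : γ / ‖v‖ ≤ 1 := (div_le_one hv0).2 (by linarith)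
      have h4 : 0 ≤ γ / ‖v‖ := by positivity
      have h5 : |‖w‖ - ‖v‖| ≤ ‖v - w‖ := abs_le.2 ⟨by linarith, by linarith⟩
      rw [e, abs_mul, abs_of_nonneg h4]
      nlinarith [abs_nonneg (‖w‖ - ‖v‖)]
  rwa [abs_mul, abs_of_nonneg hw] at main

/-- Clipping is projection onto a ball, so the sharp constant is 1. The constant 2 suffices and
comes from varying the vector and the coefficient separately. -/
lemma norm_clip_sub_clip_le (hγ : 0 < γ) :
    ‖clipCoeff γ v • v - clipCoeff γ w • w‖ ≤ 2 * ‖v - w‖ := by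
  have e : clipCoeff γ v • v - clipCoeff γ w • w
      = clipCoeff γ v • (v - w) + (clipCoeff γ v - clipCoeff γ w) • w := by
    rw [smul_sub, sub_smul]
    abel
  rw [e]
  refine (norm_add_le _ _).trans ?_
  rw [norm_smul, norm_smul, Real.norm_of_nonneg (clipCoeff_nonneg hγ), Real.norm_eq_abs]
  have := mul_le_mul_of_nonneg_right (clipCoeff_le_one (v := v) hγ) (norm_nonneg (v - w))
  linarith [abs_clipCoeff_sub_mul_le (v := v) (w := w) hγ]

end Clip

/-! ### Convexity, smoothness and the drift of clipped gradients. -/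

section Objective

lemma sub_le_inner_gradient {d : ℕ} {f : EuclideanSpace ℝ (Fin d) → ℝ}
    (hf : ConvexOn ℝ Set.univ f) (hd : Differentiable ℝ f) (x y : EuclideanSpace ℝ (Fin d)) :
    f x - f y ≤ inner ℝ (gradient f x) (x - y) := by
  have hc : ConvexOn ℝ Set.univ (f ∘ AffineMap.lineMap (k := ℝ) x y) := by
    simpa using hf.comp_affineMap (AffineMap.lineMap (k := ℝ) x y)
  have hl : HasDerivAt (AffineMap.lineMap (k := ℝ) x y) (y - x) 0 := AffineMap.hasDerivAt_lineMap
  have hfd : HasFDerivAt f (fderiv ℝ f x) (AffineMap.lineMap (k := ℝ) x y (0 : ℝ)) := by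
    simpa using (hd x).hasFDerivAt
  have h := hc.le_slope_of_hasDerivAt (Set.mem_univ 0) (Set.mem_univ 1) one_pos
    (hfd.comp_hasDerivAt 0 hl)
  simp only [slope_def_field, Function.comp_apply, AffineMap.lineMap_apply_one,
    AffineMap.lineMap_apply_zero, sub_zero, div_one] at h
  rw [inner_gradient_left, ← neg_sub y x, map_neg]
  linarith

lemma gradient_eq_zero_of_forall_le {d : ℕ} {f : EuclideanSpace ℝ (Fin d) → ℝ}
    {z : EuclideanSpace ℝ (Fin d)} (h : ∀ x, f z ≤ f x) : gradient f z = 0 := by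
  have : IsLocalMin f z := Eventually.of_forall h
  simp [gradient, this.fderiv_eq_zero]

variable {n d : ℕ} {f : Fin n → EuclideanSpace ℝ (Fin d) → ℝ} {N : Finset (Fin n)} {L μ : ℝ}
  {xstar : EuclideanSpace ℝ (Fin d)}

lemma inner_gradient_avgObjective (hd : ∀ i ∈ N, Differentiable ℝ (f i))
    (x y : EuclideanSpace ℝ (Fin d)) :
    inner ℝ (gradient (avgObjective f N) x) y
      = 1 / (N.card : ℝ) * ∑ i ∈ N, inner ℝ (gradient (f i) x) y := by
  simp only [inner_gradient_left]
  have h : HasFDerivAt (avgObjective f N)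
      ((1 / (N.card : ℝ)) • ∑ i ∈ N, fderiv ℝ (f i) x) x :=
    (HasFDerivAt.fun_sum fun i hi => ((hd i hi) x).hasFDerivAt).const_mul _
  rw [h.fderiv]
  simp

namespace ObjectiveAssumptions

variable (h : ObjectiveAssumptions f N L μ xstar)
include h

lemma norm_gradient_le {i : Fin n} (hi : i ∈ N) (x : EuclideanSpace ℝ (Fin d)) :
    ‖gradient (f i) x‖ ≤ L * ‖x - xstar‖ := by
  have := h.smooth i hi x xstar
  rwa [gradient_eq_zero_of_forall_le (h.common_minimizer i hi), sub_zero] at this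

lemma inner_gradient_nonneg {i : Fin n} (hi : i ∈ N) (x : EuclideanSpace ℝ (Fin d)) :
    0 ≤ inner ℝ (gradient (f i) x) (x - xstar) := by
  have := sub_le_inner_gradient (h.convex i hi) (h.differentiable i hi) x xstar
  linarith [h.common_minimizer i hi x]

/-- Add the strong convexity inequalities from `x` to `xstar` and back; the gradients at `xstar`
vanish one by one because the minimizer is common. -/
lemma sum_inner_gradient_ge (hN : 0 < N.card) (x : EuclideanSpace ℝ (Fin d)) :
    N.card * μ * ‖x - xstar‖ ^ 2 ≤ ∑ i ∈ N, inner ℝ (gradient (f i) x) (x - xstar) := by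
  have hN' : (0 : ℝ) < N.card := by exact_mod_cast hN
  have h1 := h.strongly_convex x xstar
  have h2 := h.strongly_convex xstar x
  have h0 : ∑ i ∈ N, inner ℝ (gradient (f i) xstar) (x - xstar) = 0 :=
    Finset.sum_eq_zero fun i hi => by
      rw [gradient_eq_zero_of_forall_le (h.common_minimizer i hi), inner_zero_left]
  rw [inner_gradient_avgObjective h.differentiable, h0] at h2
  rw [← neg_sub x xstar, inner_neg_right, norm_neg,
    inner_gradient_avgObjective h.differentiable] at h1
  set S := ∑ i ∈ N, inner ℝ (gradient (f i) x) (x - xstar)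
  have h3 : μ * ‖x - xstar‖ ^ 2 ≤ 1 / (N.card : ℝ) * S := by linarith
  have h4 := mul_le_mul_of_nonneg_left h3 hN'.le
  rw [← mul_assoc, ← mul_assoc, mul_one_div_cancel hN'.ne', one_mul] at h4
  exact h4

lemma avgObjective_sub_le (hN : 0 < N.card) (x : EuclideanSpace ℝ (Fin d)) :
    avgObjective f N x - avgObjective f N xstar ≤ L * ‖x - xstar‖ ^ 2 := by
  have hN' : (0 : ℝ) < N.card := by exact_mod_cast hN
  unfold avgObjective
  rw [← mul_sub, ← Finset.sum_sub_distrib]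
  have : ∑ i ∈ N, (f i x - f i xstar) ≤ ∑ _i ∈ N, L * ‖x - xstar‖ ^ 2 := by
    refine Finset.sum_le_sum fun i hi => ?_
    refine (sub_le_inner_gradient (h.convex i hi) (h.differentiable i hi) x xstar).trans ?_
    refine (real_inner_le_norm _ _).trans ?_
    rw [sq, ← mul_assoc]
    exact mul_le_mul_of_nonneg_right (h.norm_gradient_le hi x) (norm_nonneg _)
  rw [Finset.sum_const, nsmul_eq_mul] at this
  have h4 := mul_le_mul_of_nonneg_left this (by positivity : 0 ≤ 1 / (N.card : ℝ))
  rwa [← mul_assoc, one_div_mul_cancel hN'.ne', one_mul] at h4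

lemma avgObjective_sub_nonneg (x : EuclideanSpace ℝ (Fin d)) :
    0 ≤ avgObjective f N x - avgObjective f N xstar := by
  unfold avgObjective
  rw [← mul_sub, ← Finset.sum_sub_distrib]
  exact mul_nonneg (by positivity)
    (Finset.sum_nonneg fun i hi => sub_nonneg.2 (h.common_minimizer i hi x))

/-- Away from the minimizer, clipped directions of the unattacked agents outweigh arbitrary clipped
directions of the attacked ones. -/
lemma sum_inner_clip_ge (hN : 0 < N.card) {γ : ℝ} (hγ : 0 < γ)
    (v : Fin n → EuclideanSpace ℝ (Fin d)) (x : EuclideanSpace ℝ (Fin d))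
    (hx : γ ≤ L * ‖x - xstar‖) :
    (N.card * (μ / L) - (Nᶜ.card : ℝ)) * γ * ‖x - xstar‖
        - 2 * (∑ j ∈ N, ‖v j - gradient (f j) x‖) * ‖x - xstar‖
      ≤ ∑ j, inner ℝ (clipCoeff γ (v j) • v j) (x - xstar) := by
  have hL := h.L_pos
  set D := ‖x - xstar‖ with hD
  have hD0 : 0 < D := pos_of_mul_pos_right (hγ.trans_le hx) hL.le
  have hatt : -((Nᶜ.card : ℝ) * (γ * D))
      ≤ ∑ j ∈ Nᶜ, inner ℝ (clipCoeff γ (v j) • v j) (x - xstar) := by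
    rw [← mul_neg, ← nsmul_eq_mul, ← Finset.sum_const]
    refine Finset.sum_le_sum fun j _ => ?_
    have h1 := abs_real_inner_le_norm (clipCoeff γ (v j) • v j) (x - xstar)
    have h2 := mul_le_mul_of_nonneg_right (norm_clip_le (v := v j) hγ) hD0.le
    linarith [neg_abs_le (inner ℝ (clipCoeff γ (v j) • v j) (x - xstar))]
  have hgood : ∀ j ∈ N, γ / (L * D) * inner ℝ (gradient (f j) x) (x - xstar)
      - 2 * ‖v j - gradient (f j) x‖ * D ≤ inner ℝ (clipCoeff γ (v j) • v j) (x - xstar) := by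
    intro j hj
    -- The clipped exact gradient carries the drift: its inner product is nonnegative for each
    -- single agent, so the lower bound on the coefficient may be multiplied in. Passing to `v j`
    -- costs twice the estimation error.
    have h1 := mul_le_mul_of_nonneg_right
      (le_clipCoeff hγ hx (h.norm_gradient_le hj x)) (h.inner_gradient_nonneg hj x)
    have h2 := abs_real_inner_le_norm (clipCoeff γ (v j) • v j
      - clipCoeff γ (gradient (f j) x) • gradient (f j) x) (x - xstar)
    have h3 := mul_le_mul_of_nonneg_right
      (norm_clip_sub_clip_le (v := v j) (w := gradient (f j) x) hγ) hD0.le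
    have h4 := neg_abs_le (inner ℝ (clipCoeff γ (v j) • v j
      - clipCoeff γ (gradient (f j) x) • gradient (f j) x) (x - xstar))
    rw [inner_sub_left, real_inner_smul_left _ _ (clipCoeff γ (gradient (f j) x))] at h2 h4
    linarith
  have hsum := Finset.sum_le_sum hgood
  rw [Finset.sum_sub_distrib, ← Finset.mul_sum, ← Finset.sum_mul, ← Finset.mul_sum] at hsum
  have hs := mul_le_mul_of_nonneg_left (h.sum_inner_gradient_ge hN x)
    (by positivity : 0 ≤ γ / (L * D))
  have e : γ / (L * D) * (N.card * μ * D ^ 2) = N.card * (μ / L) * γ * D := by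
    field_simp
  rw [← Finset.sum_add_sum_compl N]
  rw [← hD, e] at hs
  linarith

end ObjectiveAssumptions

end Objective

/-! ### Spectral contraction of the mixing matrix. -/

namespace NetworkAssumptions

variable {n d : ℕ} {G : SimpleGraph (Fin n)} {W : Matrix (Fin n) (Fin n) ℝ}

open Matrix in
lemma dotProduct_mulVec_eigenvectorBasis (h : W.IsHermitian) (j : Fin n) (y : Fin n → ℝ) :
    (h.eigenvectorBasis j).ofLp ⬝ᵥ (W *ᵥ y)
      = h.eigenvalues j * ((h.eigenvectorBasis j).ofLp ⬝ᵥ y) := by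
  have ht : Wᵀ = W := by simpa [Matrix.conjTranspose_eq_transpose_of_trivial] using h.eq
  rw [dotProduct_mulVec, ← mulVec_transpose, ht, h.mulVec_eigenvectorBasis, smul_dotProduct,
    smul_eq_mul]

lemma sum_sq_eq_sum_sq_eigen (h : W.IsHermitian) (y : Fin n → ℝ) :
    ∑ j, ((h.eigenvectorBasis j).ofLp ⬝ᵥ y) ^ 2 = ∑ i, y i ^ 2 := by
  have := h.eigenvectorBasis.sum_sq_norm_inner_right (WithLp.toLp 2 y)
  rw [EuclideanSpace.norm_sq_eq] at this
  simpa [EuclideanSpace.inner_eq_star_dotProduct, dotProduct_comm] using this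

open Matrix in
/-- On vectors with zero sum, `W` contracts the Euclidean norm. -/
lemma exists_contraction (hW : NetworkAssumptions G W) :
    ∃ r : ℝ, 0 ≤ r ∧ r < 1 ∧ ∀ y : Fin n → ℝ, ∑ i, y i = 0 →
      ∑ i, (∑ j, W i j * y j) ^ 2 ≤ r ^ 2 * ∑ i, y i ^ 2 := by
  obtain ⟨i₀, h1, hlt⟩ := hW.spectral_gap
  set h := hW.symm
  obtain ⟨r, hr0, hr1, hr⟩ : ∃ r : ℝ, 0 ≤ r ∧ r < 1 ∧ ∀ j ≠ i₀, |h.eigenvalues j| ≤ r := by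
    rcases (Finset.univ.erase i₀).eq_empty_or_nonempty with he | he
    · refine ⟨0, le_rfl, one_pos, fun j hj => ?_⟩
      have : j ∈ Finset.univ.erase i₀ := by simp [hj]
      simp [he] at this
    · obtain ⟨k, hk, hmax⟩ := Finset.exists_max_image _ (fun j => |h.eigenvalues j|) he
      exact ⟨|h.eigenvalues k|, abs_nonneg _, hlt k (by simpa using hk),
        fun j hj => hmax j (by simp [hj])⟩
  have hone : W *ᵥ (fun _ => (1 : ℝ)) = fun _ => 1 := by
    ext i
    simp [mulVec, dotProduct, hW.row_sum i]
  have horth : ∀ j ≠ i₀, (h.eigenvectorBasis j).ofLp ⬝ᵥ (fun _ => (1 : ℝ)) = 0 := by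
    intro j hj
    have h2 := dotProduct_mulVec_eigenvectorBasis h j (fun _ => (1 : ℝ))
    rw [hone] at h2
    have h3 : h.eigenvalues j ≠ 1 := fun he => by
      have := hlt j hj
      rw [he, abs_one] at this
      exact lt_irrefl _ this
    by_contra hne
    exact h3 (mul_right_cancel₀ hne (by linarith))
  refine ⟨r, hr0, hr1, fun y hy => ?_⟩
  have hn : 0 < n := i₀.pos
  -- By `horth` the constant vector is a multiple of eigenvector `i₀`, so Parseval's sum for its
  -- product with `y` has one term. The factor from the constant vector is nonzero, since its square
  -- is `n`.
  have hy0 : (h.eigenvectorBasis i₀).ofLp ⬝ᵥ y = 0 := by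
    have h4 := h.eigenvectorBasis.sum_inner_mul_inner (WithLp.toLp 2 (fun _ : Fin n => (1 : ℝ)))
      (WithLp.toLp 2 y)
    simp only [EuclideanSpace.inner_eq_star_dotProduct, star_trivial] at h4
    rw [Finset.sum_eq_single i₀ (fun j _ hj => by rw [horth j hj, zero_mul]) (by simp)] at h4
    have h5 : y ⬝ᵥ (fun _ => (1 : ℝ)) = 0 := by simpa [dotProduct] using hy
    rw [h5] at h4
    rcases mul_eq_zero.1 h4 with h6 | h6
    · have h7 := sum_sq_eq_sum_sq_eigen h (fun _ => (1 : ℝ))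
      rw [Finset.sum_eq_single i₀ (fun j _ hj => by rw [horth j hj]; simp) (by simp), h6] at h7
      have h8 : (n : ℝ) = 0 := by simpa using h7.symm
      exact absurd (by exact_mod_cast h8) hn.ne'
    · rwa [dotProduct_comm]
  have e : ∀ i, ∑ j, W i j * y j = (W *ᵥ y) i := fun i => rfl
  simp only [e]
  rw [← sum_sq_eq_sum_sq_eigen h (W *ᵥ y), ← sum_sq_eq_sum_sq_eigen h y, Finset.mul_sum]
  refine Finset.sum_le_sum fun j _ => ?_
  rw [dotProduct_mulVec_eigenvectorBasis, mul_pow]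
  by_cases hj : j = i₀
  · rw [hj, hy0]
    simp
  · exact mul_le_mul_of_nonneg_right (sq_le_sq' (abs_le.1 (hr j hj)).1 (abs_le.1 (hr j hj)).2) (sq_nonneg _)

lemma exists_contraction_piLp (hW : NetworkAssumptions G W) :
    ∃ r : ℝ, 0 ≤ r ∧ r < 1 ∧ ∀ y : Fin n → EuclideanSpace ℝ (Fin d), ∑ i, y i = 0 →
      ‖WithLp.toLp 2 (fun i => ∑ j, W i j • y j)‖ ≤ r * ‖WithLp.toLp 2 y‖ := by
  obtain ⟨r, h0, h1, hr⟩ := hW.exists_contraction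
  refine ⟨r, h0, h1, fun y hy => ?_⟩
  refine le_of_sq_le_sq ?_ (by positivity)
  rw [mul_pow, PiLp.norm_sq_eq_of_L2, PiLp.norm_sq_eq_of_L2]
  simp only [EuclideanSpace.norm_sq_eq, Real.norm_eq_abs, sq_abs]
  rw [Finset.sum_comm, Finset.sum_comm (f := fun i k => (y i).ofLp k ^ 2), Finset.mul_sum]
  refine Finset.sum_le_sum fun k _ => ?_
  have hk : ∑ i, (y i).ofLp k = 0 := by
    have := congrArg (fun z : EuclideanSpace ℝ (Fin d) => z.ofLp k) hy
    simpa using this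
  simpa using hr (fun i => (y i).ofLp k) hk

end NetworkAssumptions

/-! ### Averaged noise. -/

/-- Exponential averaging of a sequence with weights `η`. -/
def expFilter {E : Type*} [AddCommGroup E] [Module ℝ E] (η : ℕ → ℝ) (ξ : ℕ → E) : ℕ → E
  | 0 => ξ 0
  | t + 1 => (1 - η t) • expFilter η ξ t + η t • ξ (t + 1)

section Noise

variable {d : ℕ} {Ω : Type u} [MeasurableSpace Ω] {P : Measure Ω}

lemma integral_inner_eq_zero {X Y : Ω → EuclideanSpace ℝ (Fin d)} (h : IndepFun X Y P)
    (hX : Integrable X P) (hY : Integrable Y P) (h0 : ∫ ω, X ω ∂P = 0) :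
    ∫ ω, inner ℝ (X ω) (Y ω) ∂P = 0 := by
  have := h.integral_bilin hX hY (innerSL ℝ)
  rw [h0, map_zero] at this
  exact this

/-- Tonelli: the sum has finite expectation, so it is finite almost surely. -/
lemma ae_summable_of_summable_integral {F : ℕ → Ω → ℝ} (hF : ∀ t ω, 0 ≤ F t ω)
    (hint : ∀ t, Integrable (F t) P) (hsum : Summable fun t => ∫ ω, F t ω ∂P) :
    ∀ᵐ ω ∂P, Summable fun t => F t ω := by
  have h1 : ∫⁻ ω, ∑' t, ENNReal.ofReal (F t ω) ∂P ≠ ⊤ := by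
    rw [lintegral_tsum fun t => (hint t).aemeasurable.ennreal_ofReal]
    have : ∀ t, ∫⁻ ω, ENNReal.ofReal (F t ω) ∂P = ENNReal.ofReal (∫ ω, F t ω ∂P) := fun t =>
      (ofReal_integral_eq_lintegral_ofReal (hint t) (Eventually.of_forall (hF t))).symm
    simp only [this]
    exact hsum.tsum_ofReal_ne_top
  have h2 : AEMeasurable (fun ω => ∑' t, ENNReal.ofReal (F t ω)) P :=
    AEMeasurable.tsum fun t => (hint t).aemeasurable.ennreal_ofReal
  filter_upwards [ae_lt_top' h2 h1] with ω hω
  have := ENNReal.summable_toReal hω.ne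
  simpa only [ENNReal.toReal_ofReal (hF _ ω)] using this

variable {X : ℕ → Ω → EuclideanSpace ℝ (Fin d)} {η : ℕ → ℝ}

lemma memLp_expFilter (hX : ∀ t, MemLp (X t) 2 P) (t : ℕ) :
    MemLp (fun ω => expFilter η (fun s => X s ω) t) 2 P := by
  induction t with
  | zero => exact hX 0
  | succ t ih => exact (ih.const_smul (1 - η t)).add ((hX (t + 1)).const_smul (η t))

lemma integrable_inner_of_memLp {Y Z : Ω → EuclideanSpace ℝ (Fin d)} (hY : MemLp Y 2 P)
    (hZ : MemLp Z 2 P) : Integrable (fun ω => inner ℝ (Y ω) (Z ω)) P :=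
  (hY.norm.integrable_mul hZ.norm).mono'
    (hY.aestronglyMeasurable.inner hZ.aestronglyMeasurable)
    (Eventually.of_forall fun ω => norm_inner_le_norm (Y ω) (Z ω))

variable [IsProbabilityMeasure P]

/-- The filter is linear in past noise, so pairwise independence is enough and no filtration is
needed. -/
lemma integral_inner_expFilter (hX : ∀ t, MemLp (X t) 2 P)
    (hind : Pairwise fun s t => IndepFun (X s) (X t) P) (h0 : ∀ t, ∫ ω, X t ω ∂P = 0) (t : ℕ) :
    ∀ s, t < s → ∫ ω, inner ℝ (expFilter η (fun r => X r ω) t) (X s ω) ∂P = 0 := by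
  have hI : ∀ t, Integrable (X t) P := fun t => (hX t).integrable one_le_two
  induction t with
  | zero =>
    intro s hs
    exact integral_inner_eq_zero (hind hs.ne) (hI 0) (hI s) (h0 0)
  | succ t ih =>
    intro s hs
    simp only [expFilter, inner_add_left, real_inner_smul_left]
    rw [integral_add ((integrable_inner_of_memLp (memLp_expFilter hX t) (hX s)).const_mul _)
      ((integrable_inner_of_memLp (hX (t + 1)) (hX s)).const_mul _),
      integral_const_mul, integral_const_mul, ih s (by omega),
      integral_inner_eq_zero (hind hs.ne) (hI _) (hI s) (h0 _)]
    simp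

lemma integral_sq_norm_expFilter_succ (hX : ∀ t, MemLp (X t) 2 P)
    (hind : Pairwise fun s t => IndepFun (X s) (X t) P) (h0 : ∀ t, ∫ ω, X t ω ∂P = 0) (t : ℕ) :
    ∫ ω, ‖expFilter η (fun r => X r ω) (t + 1)‖ ^ 2 ∂P
      = (1 - η t) ^ 2 * ∫ ω, ‖expFilter η (fun r => X r ω) t‖ ^ 2 ∂P
        + η t ^ 2 * ∫ ω, ‖X (t + 1) ω‖ ^ 2 ∂P := by
  have hu := memLp_expFilter (η := η) hX t
  have e : ∀ ω, ‖expFilter η (fun r => X r ω) (t + 1)‖ ^ 2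
      = (1 - η t) ^ 2 * ‖expFilter η (fun r => X r ω) t‖ ^ 2
        + η t ^ 2 * ‖X (t + 1) ω‖ ^ 2
        + 2 * (1 - η t) * η t * inner ℝ (expFilter η (fun r => X r ω) t) (X (t + 1) ω) := by
    intro ω
    simp only [expFilter]
    rw [norm_add_sq_real, norm_smul, norm_smul, real_inner_smul_left, real_inner_smul_right,
      mul_pow, mul_pow, Real.norm_eq_abs, Real.norm_eq_abs, sq_abs, sq_abs]
    ring
  have i1 : Integrable (fun ω => ‖expFilter η (fun r => X r ω) t‖ ^ 2) P :=
    hu.integrable_norm_pow two_ne_zero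
  have i2 : Integrable (fun ω => ‖X (t + 1) ω‖ ^ 2) P := (hX _).integrable_norm_pow two_ne_zero
  have i3 := integrable_inner_of_memLp hu (hX (t + 1))
  have i12 : Integrable (fun ω => (1 - η t) ^ 2 * ‖expFilter η (fun r => X r ω) t‖ ^ 2
      + η t ^ 2 * ‖X (t + 1) ω‖ ^ 2) P := (i1.const_mul _).add (i2.const_mul _)
  simp only [e]
  rw [integral_add i12 (i3.const_mul _),
    integral_add (i1.const_mul _) (i2.const_mul _), integral_const_mul, integral_const_mul,
    integral_const_mul, integral_inner_expFilter hX hind h0 t _ (Nat.lt_succ_self t)]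
  ring

/-- The second moment of averaged noise is of the order of the averaging weight. -/
lemma exists_integral_sq_norm_expFilter_le {σ c τ : ℝ} {φ : ℕ} (hφ : 0 < φ)
    (hη : PowerSeqOK c φ τ) (hτ0 : 0 ≤ τ) (hτ : τ < 1) (hX : ∀ t, MemLp (X t) 2 P)
    (hind : Pairwise fun s t => IndepFun (X s) (X t) P) (h0 : ∀ t, ∫ ω, X t ω ∂P = 0)
    (h2 : ∀ t, ∫ ω, ‖X t ω‖ ^ 2 ∂P ≤ σ ^ 2) :
    ∃ C, 0 ≤ C ∧ ∀ t, ∫ ω, ‖expFilter (powerSeq c φ τ) (fun r => X r ω) t‖ ^ 2 ∂P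
      ≤ C * powerSeq c φ τ t := by
  have hc := hη.1
  refine exists_bound_of_contraction (a := powerSeq c φ τ) (K := σ ^ 2)
    (powerSeq_pos hc hφ) (fun t => ⟨(hη.2 t).1.le, (hη.2 t).2.le⟩) (sq_nonneg σ) ?_ ?_
  · intro t
    rw [integral_sq_norm_expFilter_succ hX hind h0]
    obtain ⟨e1, e2⟩ := hη.2 t
    set e := powerSeq c φ τ t
    have hI : 0 ≤ ∫ ω, ‖expFilter (powerSeq c φ τ) (fun r => X r ω) t‖ ^ 2 ∂P :=
      integral_nonneg fun ω => sq_nonneg _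
    have := mul_le_mul_of_nonneg_left (h2 (t + 1)) (sq_nonneg e)
    -- Since `(1 - e) ^ 2 ≤ 1 - e`, the second moment contracts at rate `e` with perturbation `σ ^ 2
    -- * e * e`.
    nlinarith [mul_nonneg (mul_nonneg e1.le (sub_nonneg.2 e2.le)) hI]
  · have := eventually_powerSeq_slow (c := c) (c' := c / 2) hc (by positivity) hφ hτ0 hτ
    filter_upwards [this] with t ht
    have e : powerSeq (c / 2) φ τ t = powerSeq c φ τ t / 2 := by
      unfold powerSeq
      ring
    rwa [e] at ht

end Noise

/-! ### The averaged iterate, consensus and tracking along one path. -/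

/-- The network average of the iterates. -/
def meanIterate {n d : ℕ} (x : Fin n → ℕ → EuclideanSpace ℝ (Fin d)) (t : ℕ) :
    EuclideanSpace ℝ (Fin d) :=
  (1 / (n : ℝ)) • ∑ i, x i t

lemma norm_average_le {n d : ℕ} (hn : 0 < n) {b : ℝ} {z : Fin n → EuclideanSpace ℝ (Fin d)}
    (hz : ∀ i, ‖z i‖ ≤ b) : ‖(1 / (n : ℝ)) • ∑ i, z i‖ ≤ b := by
  have hn' : (0 : ℝ) < n := by exact_mod_cast hn
  rw [norm_smul, Real.norm_of_nonneg (by positivity), one_div, inv_mul_le_iff₀ hn']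
  calc ‖∑ i, z i‖ ≤ ∑ i, ‖z i‖ := norm_sum_le _ _
    _ ≤ ∑ _i : Fin n, b := Finset.sum_le_sum fun i _ => hz i
    _ = n * b := by simp

lemma norm_toLp_le {n d : ℕ} {b : ℝ} (hb : 0 ≤ b) {z : Fin n → EuclideanSpace ℝ (Fin d)}
    (hz : ∀ i, ‖z i‖ ≤ b) : ‖WithLp.toLp 2 z‖ ≤ n * b := by
  refine le_of_sq_le_sq ?_ (by positivity)
  rw [PiLp.norm_sq_eq_of_L2, mul_pow]
  have h1 : ∑ i, ‖z i‖ ^ 2 ≤ ∑ _i : Fin n, b ^ 2 :=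
    Finset.sum_le_sum fun i _ => pow_le_pow_left₀ (norm_nonneg _) (hz i) 2
  have h2 : (n : ℝ) ≤ (n : ℝ) ^ 2 := by exact_mod_cast Nat.le_self_pow two_ne_zero n
  simp only [Finset.sum_const, Finset.card_univ, Fintype.card_fin, nsmul_eq_mul] at h1
  exact h1.trans (mul_le_mul_of_nonneg_right h2 (sq_nonneg b))

lemma norm_le_norm_toLp {n d : ℕ} (z : Fin n → EuclideanSpace ℝ (Fin d)) (i : Fin n) :
    ‖z i‖ ≤ ‖WithLp.toLp 2 z‖ :=
  PiLp.norm_apply_le (WithLp.toLp 2 z) i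

/-- Passes from a recursion for the squared distance to one for the distance. The linear error
becomes quadratic, so second moments of the noise suffice later. -/
lemma le_of_sq_le_drift {D D' A g δ L S n : ℝ} (hA : 0 < A) (hg : 0 < g) (hδ : 0 < δ)
    (hL : 0 < L) (hn : 0 < n) (ht1 : A * δ * L ≤ 1) (ht2 : A * (2 * L) ≤ δ) (hfar : g ≤ L * D)
    (h3 : D' ^ 2 ≤ D ^ 2 - 2 * A * (δ * g * D - 2 * (S / n) * D) + (A * g) ^ 2) :
    D' ≤ D - δ / 2 * (A * g) + 4 / (n ^ 2 * δ) * (A / g) * S ^ 2 := by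
  have hD0 : 0 < D := pos_of_mul_pos_right (hg.trans_le hfar) hL.le
  set a := δ * (A * g) with ha
  have ha0 : 0 < a := by positivity
  set b := 2 * A * (S / n) with hb
  have e2 : 4 / (n ^ 2 * δ) * (A / g) * S ^ 2 = b ^ 2 / a := by
    rw [hb, ha]
    field_simp
    ring
  have e3 : δ / 2 * (A * g) = a / 2 := by
    rw [ha]
    ring
  rw [e2, e3]
  -- Young's inequality, from `(b - a / 2) ^ 2 ≥ 0`.
  have hh : b - a / 4 ≤ b ^ 2 / a := by
    rw [le_div_iff₀ ha0]
    nlinarith [sq_nonneg (b - a / 2)]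
  have haD : a ≤ D := by
    have h6 : L * a ≤ g := by
      have := mul_le_mul_of_nonneg_right ht1 hg.le
      rw [ha]
      linarith
    exact le_of_mul_le_mul_left (h6.trans hfar) hL
  have hsq : (A * g) ^ 2 ≤ a / 2 * D := by
    have h7 : A * (2 * L) * g ≤ δ * (L * D) :=
      mul_le_mul ht2 hfar hg.le hδ.le
    have h8 : A * g ≤ δ * D / 2 := by
      refine le_of_mul_le_mul_left ?_ hL
      linarith
    have := mul_le_mul_of_nonneg_left h8 (mul_pos hA hg).le
    rw [ha]
    nlinarith
  have hq : 0 ≤ b ^ 2 / a := by positivity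
  have h9 : D ^ 2 - 2 * A * (δ * g * D - 2 * (S / n) * D) = D ^ 2 - 2 * a * D + 2 * b * D := by
    rw [ha, hb]
    ring
  rw [h9] at h3
  have h10 := mul_le_mul_of_nonneg_right hh hD0.le
  have h11 : 0 ≤ D - a / 2 + b ^ 2 / a := by linarith only [hq, haD, ha0]
  generalize b ^ 2 / a = q at h10 h11 ⊢
  refine le_of_sq_le_sq (h3.trans ?_) h11
  nlinarith only [sq_nonneg (q - a / 2), hsq, h10]

namespace IsPath

variable {n d : ℕ} {f : Fin n → EuclideanSpace ℝ (Fin d) → ℝ} {N : Finset (Fin n)}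
  {L μ : ℝ} {xstar : EuclideanSpace ℝ (Fin d)} {G : SimpleGraph (Fin n)}
  {W : Matrix (Fin n) (Fin n) ℝ} {ξ x v m : Fin n → ℕ → EuclideanSpace ℝ (Fin d)}

lemma meanIterate_succ {α γ η : ℕ → ℝ} (hp : IsPath f N W α γ η ξ x v m)
    (hW : NetworkAssumptions G W) (t : ℕ) :
    meanIterate x (t + 1) = meanIterate x t
      - α t • ((1 / (n : ℝ)) • ∑ j, clipCoeff (γ t) (v j t) • v j t) := by
  unfold meanIterate
  simp only [hp.step_x]
  rw [Finset.sum_comm]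
  simp only [← Finset.sum_smul, hW.col_sum, one_smul]
  rw [Finset.sum_sub_distrib, ← Finset.smul_sum, smul_sub, smul_comm]

/-- The disagreement in the network decays like the size of the clipped steps. -/
lemma exists_consensus_bound {α γ η : ℕ → ℝ} (hp : IsPath f N W α γ η ξ x v m)
    (hW : NetworkAssumptions G W) (hn : 0 < n) (hα : ∀ t, 0 < α t) (hγ : ∀ t, 0 < γ t)
    (hslow : ∀ k > 0, ∀ᶠ t in atTop, (1 - k) * (α t * γ t) ≤ α (t + 1) * γ (t + 1)) :
    ∃ C, 0 ≤ C ∧ ∀ i t, ‖x i t - meanIterate x t‖ ≤ C * (α t * γ t) := by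
  have hn' : (0 : ℝ) < n := by exact_mod_cast hn
  obtain ⟨r, hr0, hr1, hr⟩ := hW.exists_contraction_piLp (d := d)
  have hr' : 0 < 1 - r := by linarith
  have hstep : ∀ t, ‖WithLp.toLp 2 (fun i => x i (t + 1) - meanIterate x (t + 1))‖
      ≤ (1 - (1 - r)) * ‖WithLp.toLp 2 (fun i => x i t - meanIterate x t)‖
        + 2 * n / (1 - r) * (1 - r) * (α t * γ t) := by
    intro t
    set c : Fin n → EuclideanSpace ℝ (Fin d) := fun j => clipCoeff (γ t) (v j t) • v j t with hc
    set cb := (1 / (n : ℝ)) • ∑ j, c j with hcb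
    have hm := hp.meanIterate_succ hW t
    have hz : ∀ j, x j t - α t • c j - meanIterate x (t + 1)
        = (x j t - meanIterate x t) - α t • (c j - cb) := by
      intro j
      rw [hm, smul_sub]
      abel
    -- Row sums equal to one allow subtracting the new average before mixing; the mixed vector then
    -- has zero sum, where `W` contracts.
    have hx : ∀ i, x i (t + 1) - meanIterate x (t + 1)
        = ∑ j, W i j • (x j t - α t • c j - meanIterate x (t + 1)) := by
      intro i
      simp only [smul_sub _ _ (meanIterate x (t + 1)), Finset.sum_sub_distrib]
      rw [← Finset.sum_smul, hW.row_sum, one_smul, hp.step_x]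
    have hsum : ∑ j, (x j t - α t • c j - meanIterate x (t + 1)) = 0 := by
      rw [Finset.sum_sub_distrib, Finset.sum_sub_distrib, ← Finset.smul_sum, hm]
      simp only [meanIterate, Finset.sum_const, Finset.card_univ, Fintype.card_fin,
        ← Nat.cast_smul_eq_nsmul ℝ]
      rw [smul_sub, smul_smul, smul_comm (n : ℝ) (α t), smul_smul (n : ℝ),
        mul_one_div_cancel hn'.ne', one_smul, one_smul, sub_self]
    have hcn : ∀ j, ‖c j‖ ≤ γ t := fun j => norm_clip_le (hγ t)
    have hd : ‖WithLp.toLp 2 (fun j => c j - cb)‖ ≤ n * (2 * γ t) := by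
      refine norm_toLp_le (by linarith [hγ t]) fun j => (norm_sub_le _ _).trans ?_
      linarith [hcn j, norm_average_le hn hcn]
    have h1 := hr _ hsum
    simp only [← hx] at h1
    have e2 : WithLp.toLp 2 (fun j => x j t - α t • c j - meanIterate x (t + 1))
        = WithLp.toLp 2 (fun j => x j t - meanIterate x t)
          - α t • WithLp.toLp 2 (fun j => c j - cb) := by
      ext1 j
      exact hz j
    have h2 : ‖WithLp.toLp 2 (fun j => x j t - α t • c j - meanIterate x (t + 1))‖
        ≤ ‖WithLp.toLp 2 (fun j => x j t - meanIterate x t)‖ + α t * (n * (2 * γ t)) := by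
      rw [e2]
      refine (norm_sub_le _ _).trans ?_
      rw [norm_smul, Real.norm_of_nonneg (hα t).le]
      linarith [mul_le_mul_of_nonneg_left hd (hα t).le]
    have h3 := h1.trans (mul_le_mul_of_nonneg_left h2 hr0)
    have h4 : 2 * n / (1 - r) * (1 - r) * (α t * γ t) = 2 * n * (α t * γ t) := by
      rw [div_mul_cancel₀ _ hr'.ne']
    have h5 : 0 ≤ α t * (n * (2 * γ t)) :=
      mul_nonneg (hα t).le (by nlinarith [hγ t])
    rw [h4]
    nlinarith
  obtain ⟨C, hC, hb⟩ := exists_bound_of_contraction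
    (s := fun t => ‖WithLp.toLp 2 (fun i => x i t - meanIterate x t)‖) (a := fun _ => 1 - r)
    (b := fun t => α t * γ t) (K := 2 * n / (1 - r)) (fun t => mul_pos (hα t) (hγ t))
    (fun _ => ⟨hr'.le, by linarith⟩) (by positivity) hstep (hslow ((1 - r) / 2) (by positivity))
  exact ⟨C, hC, fun i t =>
    (norm_le_norm_toLp (fun i => x i t - meanIterate x t) i).trans (hb t)⟩

lemma norm_meanIterate_succ_sub_le {α γ η : ℕ → ℝ} (hp : IsPath f N W α γ η ξ x v m)
    (hW : NetworkAssumptions G W) (hn : 0 < n) (hα : ∀ t, 0 < α t) (hγ : ∀ t, 0 < γ t) (t : ℕ) :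
    ‖meanIterate x (t + 1) - meanIterate x t‖ ≤ α t * γ t := by
  rw [hp.meanIterate_succ hW t, sub_sub_cancel_left, norm_neg, norm_smul,
    Real.norm_of_nonneg (hα t).le]
  exact mul_le_mul_of_nonneg_left (norm_average_le hn fun j => norm_clip_le (hγ t)) (hα t).le

/-- Up to the averaged noise, the estimators track the gradients. -/
lemma exists_tracking_bound {α γ η : ℕ → ℝ} (hp : IsPath f N W α γ η ξ x v m)
    (hO : ObjectiveAssumptions f N L μ xstar) (hη : ∀ t, η t ∈ Set.Ioo (0 : ℝ) 1)
    (hα : ∀ t, 0 < α t) (hγ : ∀ t, 0 < γ t) {K : ℝ} (hK : 0 ≤ K)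
    (hx : ∀ i t, ‖x i (t + 1) - x i t‖ ≤ K * (α t * γ t))
    (hslow : ∀ᶠ t in atTop, (1 - η t / 2) * (α t * γ t / η t)
      ≤ α (t + 1) * γ (t + 1) / η (t + 1)) {i : Fin n} (hi : i ∈ N) :
    ∃ C, 0 ≤ C ∧ ∀ t, ‖v i t - gradient (f i) (x i t) - expFilter η (ξ i) t‖
      ≤ C * (α t * γ t / η t) := by
  refine exists_bound_of_contraction (a := η) (K := L * K)
    (fun t => div_pos (mul_pos (hα t) (hγ t)) (hη t).1) (fun t => ⟨(hη t).1.le, (hη t).2.le⟩)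
    (mul_nonneg hO.L_pos.le hK) ?_ hslow
  intro t
  -- The estimator and the filter obey the same linear recursion, so the noise cancels and only the
  -- change of the gradient drives the residual.
  have e : v i (t + 1) - gradient (f i) (x i (t + 1)) - expFilter η (ξ i) (t + 1)
      = (1 - η t) • ((v i t - gradient (f i) (x i t) - expFilter η (ξ i) t)
        + (gradient (f i) (x i t) - gradient (f i) (x i (t + 1)))) := by
    rw [hp.step_v, hp.oracle i hi, expFilter]
    module
  have h1 : 0 ≤ 1 - η t := sub_nonneg.2 (hη t).2.le
  have h2 : L * K * η t * (α t * γ t / η t) = L * (K * (α t * γ t)) := by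
    have := (hη t).1.ne'
    field_simp
  rw [e, norm_smul, Real.norm_of_nonneg h1, h2]
  have h3 := hO.smooth i hi (x i t) (x i (t + 1))
  rw [norm_sub_rev (x i t)] at h3
  have h4 := h3.trans (mul_le_mul_of_nonneg_left (hx i t) hO.L_pos.le)
  have h5 := norm_add_le (v i t - gradient (f i) (x i t) - expFilter η (ξ i) t)
    (gradient (f i) (x i t) - gradient (f i) (x i (t + 1)))
  have h6 := mul_le_mul_of_nonneg_left (h5.trans (add_le_add_right h4 _)) h1
  have h7 : 0 ≤ η t * (L * (K * (α t * γ t))) :=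
    mul_nonneg (hη t).1.le ((norm_nonneg _).trans h4)
  linarith

/-- One step of the averaged iterate, far from the minimizer relative to the clipping level. -/
lemma norm_meanIterate_succ_le {α γ η : ℕ → ℝ} (hp : IsPath f N W α γ η ξ x v m)
    (hW : NetworkAssumptions G W) (hO : ObjectiveAssumptions f N L μ xstar) (hN : 0 < N.card)
    (hn : 0 < n) (hα : ∀ t, 0 < α t) (hγ : ∀ t, 0 < γ t) {δ : ℝ} (hδ : 0 < δ)
    (hδn : n * δ ≤ N.card * (μ / L) - (Nᶜ.card : ℝ)) {t : ℕ} (ht1 : α t * δ * L ≤ 1)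
    (ht2 : α t * (2 * L) ≤ δ) (hfar : γ t ≤ L * ‖meanIterate x t - xstar‖) :
    ‖meanIterate x (t + 1) - xstar‖ ≤ ‖meanIterate x t - xstar‖ - δ / 2 * (α t * γ t)
      + 4 / (n ^ 2 * δ) * (α t / γ t)
        * (∑ j ∈ N, ‖v j t - gradient (f j) (meanIterate x t)‖) ^ 2 := by
  have hn' : (0 : ℝ) < n := by exact_mod_cast hn
  have hL := hO.L_pos
  have hα' := hα t
  have hγ' := hγ t
  set y := meanIterate x t - xstar with hy
  set D := ‖y‖ with hD
  set S := ∑ j ∈ N, ‖v j t - gradient (f j) (meanIterate x t)‖ with hS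
  set c : EuclideanSpace ℝ (Fin d) := (1 / (n : ℝ)) • ∑ j, clipCoeff (γ t) (v j t) • v j t
    with hc
  have hcn : ‖c‖ ≤ γ t := norm_average_le hn fun j => norm_clip_le hγ'
  have hD0 : 0 < D := pos_of_mul_pos_right (hγ'.trans_le hfar) hL.le
  have hinner : δ * γ t * D - 2 * (S / n) * D ≤ inner ℝ c y := by
    have h1 := hO.sum_inner_clip_ge hN hγ' (fun j => v j t) (meanIterate x t) hfar
    rw [← hy, ← hD, ← hS] at h1
    have h2 := mul_le_mul_of_nonneg_right hδn (mul_pos hγ' hD0).le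
    rw [hc, real_inner_smul_left, sum_inner]
    rw [one_div, ← div_eq_inv_mul, le_div_iff₀ hn']
    have e : (δ * γ t * D - 2 * (S / n) * D) * n = n * δ * (γ t * D) - 2 * S * D := by
      field_simp
    linarith
  have e1 : meanIterate x (t + 1) - xstar = y - α t • c := by
    rw [hp.meanIterate_succ hW t, hy]
    abel
  have h3 : ‖meanIterate x (t + 1) - xstar‖ ^ 2
      ≤ D ^ 2 - 2 * α t * (δ * γ t * D - 2 * (S / n) * D) + (α t * γ t) ^ 2 := by
    rw [e1, norm_sub_sq_real, real_inner_smul_right, norm_smul, Real.norm_of_nonneg hα'.le,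
      real_inner_comm]
    have h4 := mul_le_mul_of_nonneg_left hinner hα'.le
    have h5 := pow_le_pow_left₀ (by positivity) (mul_le_mul_of_nonneg_left hcn hα'.le) 2
    linarith
  exact le_of_sq_le_drift hα' hγ' hδ hL hn' ht1 ht2 hfar h3

end IsPath

/-! ### Path bounds for power sequences. -/

namespace IsPath

variable {n d : ℕ} {f : Fin n → EuclideanSpace ℝ (Fin d) → ℝ} {N : Finset (Fin n)}
  {L μ : ℝ} {xstar : EuclideanSpace ℝ (Fin d)} {G : SimpleGraph (Fin n)}
  {W : Matrix (Fin n) (Fin n) ℝ} {ξ x v m : Fin n → ℕ → EuclideanSpace ℝ (Fin d)}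
  {cα cγ cη τα τγ τη : ℝ} {φ : ℕ}

lemma exists_consensus_bound_powerSeq
    (hp : IsPath f N W (powerSeq cα φ τα) (powerSeq cγ φ τγ) (powerSeq cη φ τη) ξ x v m)
    (hW : NetworkAssumptions G W) (hn : 0 < n) (hφ : 0 < φ) (hα : PowerSeqOK cα φ τα)
    (hγ : PowerSeqOK cγ φ τγ) (h0 : 0 ≤ τα + τγ) :
    ∃ C, 0 ≤ C ∧ ∀ i t, ‖x i t - meanIterate x t‖
      ≤ C * (powerSeq cα φ τα t * powerSeq cγ φ τγ t) := by
  refine hp.exists_consensus_bound hW hn (powerSeq_pos hα.1 hφ) (powerSeq_pos hγ.1 hφ) ?_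
  intro k hk
  -- A constant `k` is the power sequence with exponent zero.
  filter_upwards [eventually_powerSeq_slow (c' := k) (mul_pos hα.1 hγ.1) hk hφ h0 zero_lt_one]
    with t ht
  simpa [powerSeq_mul hφ, show powerSeq k φ 0 t = k by simp [powerSeq]] using ht

/-- The squared error of the estimators is dominated by the averaged noise, up to the order of the
averaging weight. -/
lemma exists_sq_error_bound
    (hp : IsPath f N W (powerSeq cα φ τα) (powerSeq cγ φ τγ) (powerSeq cη φ τη) ξ x v m)
    (hW : NetworkAssumptions G W) (hO : ObjectiveAssumptions f N L μ xstar) (hn : 0 < n)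
    (hφ : 0 < φ) (hα : PowerSeqOK cα φ τα) (hγ : PowerSeqOK cγ φ τγ) (hη : PowerSeqOK cη φ τη)
    (hτ0 : 0 ≤ τη) (hτ1 : τη < 1) (hτ : 3 * τη ≤ 2 * (τα + τγ)) {i : Fin n} (hi : i ∈ N) :
    ∃ C, 0 ≤ C ∧ ∀ t, ‖v i t - gradient (f i) (meanIterate x t)‖ ^ 2
      ≤ 3 * ‖expFilter (powerSeq cη φ τη) (ξ i) t‖ ^ 2 + C * powerSeq cη φ τη t := by
  have hαp := powerSeq_pos (τ := τα) hα.1 hφ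
  have hγp := powerSeq_pos (τ := τγ) hγ.1 hφ
  obtain ⟨C₁, hC₁, h1⟩ := hp.exists_consensus_bound_powerSeq hW hn hφ hα hγ (by linarith)
  have hanti : ∀ t, powerSeq cα φ τα (t + 1) * powerSeq cγ φ τγ (t + 1)
      ≤ powerSeq cα φ τα t * powerSeq cγ φ τγ t := fun t => by
    simp only [powerSeq_mul hφ]
    exact powerSeq_anti (mul_pos hα.1 hγ.1) hφ (by linarith) t.le_succ
  have hx : ∀ i t, ‖x i (t + 1) - x i t‖
      ≤ (2 * C₁ + 1) * (powerSeq cα φ τα t * powerSeq cγ φ τγ t) := by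
    intro i t
    have e : x i (t + 1) - x i t = (x i (t + 1) - meanIterate x (t + 1))
        + (meanIterate x (t + 1) - meanIterate x t) - (x i t - meanIterate x t) := by abel
    rw [e]
    have h2 := norm_sub_le ((x i (t + 1) - meanIterate x (t + 1))
        + (meanIterate x (t + 1) - meanIterate x t)) (x i t - meanIterate x t)
    have h3 := norm_add_le (x i (t + 1) - meanIterate x (t + 1))
      (meanIterate x (t + 1) - meanIterate x t)
    linarith [h1 i t, h1 i (t + 1), mul_le_mul_of_nonneg_left (hanti t) hC₁,
      hp.norm_meanIterate_succ_sub_le hW hn hαp hγp t]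
  have hslow : ∀ᶠ t in atTop, (1 - powerSeq cη φ τη t / 2)
      * (powerSeq cα φ τα t * powerSeq cγ φ τγ t / powerSeq cη φ τη t)
      ≤ powerSeq cα φ τα (t + 1) * powerSeq cγ φ τγ (t + 1) / powerSeq cη φ τη (t + 1) := by
    simp only [powerSeq_mul hφ, powerSeq_div hφ]
    filter_upwards [eventually_powerSeq_slow (c' := 1 / 2 * cη) (τ := τα + τγ - τη)
      (div_pos (mul_pos hα.1 hγ.1) hη.1) (mul_pos one_half_pos hη.1) hφ (by linarith) hτ1] with t ht
    rw [← powerSeq_const_mul] at ht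
    rw [div_eq_inv_mul, ← one_div]
    exact ht
  obtain ⟨C₂, hC₂, h2⟩ := hp.exists_tracking_bound hO hη.2 hαp hγp (by positivity) hx hslow hi
  -- The condition `3 * τη ≤ 2 * (τα + τγ)` says exactly that the squared tracking error decays no
  -- slower than `η`.
  have hb1 : ∀ t, (powerSeq cα φ τα t * powerSeq cγ φ τγ t / powerSeq cη φ τη t) ^ 2
      ≤ (cα * cγ / cη) ^ 2 / cη * powerSeq cη φ τη t := by
    intro t
    rw [powerSeq_mul hφ, powerSeq_div hφ, sq, powerSeq_mul hφ, powerSeq_const_mul,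
      div_mul_cancel₀ _ hη.1.ne', ← sq]
    exact powerSeq_le_of_le (sq_nonneg _) hφ (by linarith) t
  have hb2 : ∀ t, (powerSeq cα φ τα t * powerSeq cγ φ τγ t) ^ 2
      ≤ (cα * cγ) ^ 2 / cη * powerSeq cη φ τη t := by
    intro t
    rw [powerSeq_mul hφ, sq, powerSeq_mul hφ, powerSeq_const_mul,
      div_mul_cancel₀ _ hη.1.ne', ← sq]
    exact powerSeq_le_of_le (sq_nonneg _) hφ (by linarith) t
  refine ⟨3 * C₂ ^ 2 * ((cα * cγ / cη) ^ 2 / cη) + 3 * (L * C₁) ^ 2 * ((cα * cγ) ^ 2 / cη), ?_, ?_⟩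
  · have := hη.1
    positivity
  intro t
  have hL := hO.L_pos
  have e : v i t - gradient (f i) (meanIterate x t) = expFilter (powerSeq cη φ τη) (ξ i) t
      + (v i t - gradient (f i) (x i t) - expFilter (powerSeq cη φ τη) (ξ i) t)
      + (gradient (f i) (x i t) - gradient (f i) (meanIterate x t)) := by abel
  have h3 : ‖v i t - gradient (f i) (meanIterate x t)‖
      ≤ ‖expFilter (powerSeq cη φ τη) (ξ i) t‖
        + C₂ * (powerSeq cα φ τα t * powerSeq cγ φ τγ t / powerSeq cη φ τη t)
        + L * C₁ * (powerSeq cα φ τα t * powerSeq cγ φ τγ t) := by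
    rw [e]
    refine norm_add₃_le.trans (add_le_add (add_le_add_right (h2 t) _) ?_)
    rw [mul_assoc]
    exact (hO.smooth i hi _ _).trans (mul_le_mul_of_nonneg_left (h1 i t) hL.le)
  have h4 : ∀ p q r s : ℝ, 0 ≤ p → p ≤ q + r + s → p ^ 2 ≤ 3 * q ^ 2 + 3 * r ^ 2 + 3 * s ^ 2 := by
    intro p q r s h0 h
    have := pow_le_pow_left₀ h0 h 2
    nlinarith only [this, sq_nonneg (q - r), sq_nonneg (q - s), sq_nonneg (r - s)]
  have h5 := h4 _ _ _ _ (norm_nonneg _) h3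
  rw [mul_pow C₂, mul_pow (L * C₁)] at h5
  linarith [mul_le_mul_of_nonneg_left (hb1 t) (by positivity : 0 ≤ 3 * C₂ ^ 2),
    mul_le_mul_of_nonneg_left (hb2 t) (by positivity : 0 ≤ 3 * (L * C₁) ^ 2)]

/-- If the averaged noise is square summable with weights `α / γ ^ 2`, then the averaged iterate
stays within a multiple of the clipping level from the minimizer. -/
lemma exists_dist_meanIterate_le
    (hp : IsPath f N W (powerSeq cα φ τα) (powerSeq cγ φ τγ) (powerSeq cη φ τη) ξ x v m)
    (hW : NetworkAssumptions G W) (hO : ObjectiveAssumptions f N L μ xstar) (hn : 0 < n)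
    (hN : 0 < N.card) (hδ : 0 < N.card * (μ / L) - (Nᶜ.card : ℝ))
    (hφ : 0 < φ) (hα : PowerSeqOK cα φ τα) (hγ : PowerSeqOK cγ φ τγ) (hη : PowerSeqOK cη φ τη)
    (hα0 : 0 < τα) (hα1 : τα < 1) (hγ0 : 0 ≤ τγ) (hαγ : τα + τγ ≤ 1)
    (hη0 : 0 ≤ τη) (hη1 : τη < 1) (hτ : 3 * τη ≤ 2 * (τα + τγ)) (hs : 1 < τα - 2 * τγ + τη)
    (hnoise : ∀ i ∈ N, Summable fun t => powerSeq cα φ τα t / powerSeq cγ φ τγ t ^ 2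
      * ‖expFilter (powerSeq cη φ τη) (ξ i) t‖ ^ 2) :
    ∃ C, ∀ᶠ t in atTop, ‖meanIterate x t - xstar‖ ≤ C * powerSeq cγ φ τγ t := by
  have hn' : (0 : ℝ) < n := by exact_mod_cast hn
  have hL := hO.L_pos
  have hαp := powerSeq_pos (τ := τα) hα.1 hφ
  have hγp := powerSeq_pos (τ := τγ) hγ.1 hφ
  obtain ⟨δ, hδ0, hδn⟩ : ∃ δ : ℝ, 0 < δ ∧ n * δ ≤ N.card * (μ / L) - (Nᶜ.card : ℝ) :=
    ⟨(N.card * (μ / L) - (Nᶜ.card : ℝ)) / n, div_pos hδ hn', (mul_div_cancel₀ _ hn'.ne').le⟩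
  have herr : ∀ i ∈ N, Summable fun t => powerSeq cα φ τα t / powerSeq cγ φ τγ t ^ 2
      * ‖v i t - gradient (f i) (meanIterate x t)‖ ^ 2 := by
    intro i hi
    obtain ⟨C, hC, hb⟩ := hp.exists_sq_error_bound hW hO hn hφ hα hγ hη hη0 hη1 hτ hi
    have hw : ∀ t, 0 ≤ powerSeq cα φ τα t / powerSeq cγ φ τγ t ^ 2 := fun t =>
      div_nonneg (hαp t).le (sq_nonneg _)
    have h1 : Summable fun t => powerSeq cα φ τα t / powerSeq cγ φ τγ t ^ 2
        * powerSeq cη φ τη t := by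
      have h2 : Summable (powerSeq (cα / (cγ * cγ) * cη) φ (τα - (τγ + τγ) + τη)) :=
        (summable_powerSeq_iff (mul_pos (div_pos hα.1 (mul_pos hγ.1 hγ.1)) hη.1) hφ).2
          (by linarith)
      refine h2.congr fun t => ?_
      rw [sq, powerSeq_mul hφ, powerSeq_div hφ, powerSeq_mul hφ]
    refine Summable.of_nonneg_of_le (fun t => mul_nonneg (hw t) (sq_nonneg _)) (fun t => ?_)
      (((hnoise i hi).mul_left 3).add (h1.mul_left C))
    have := mul_le_mul_of_nonneg_left (hb t) (hw t)
    linarith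
  set S : ℕ → ℝ := fun t => ∑ j ∈ N, ‖v j t - gradient (f j) (meanIterate x t)‖ with hS
  have hsum : Summable fun t => 4 / (n ^ 2 * δ) * (powerSeq cα φ τα t / powerSeq cγ φ τγ t)
      * S t ^ 2 / powerSeq cγ φ τγ t := by
    have h1 := ((summable_sum herr).mul_left (4 / (n ^ 2 * δ) * N.card))
    refine Summable.of_nonneg_of_le (fun t => ?_) (fun t => ?_) h1
    · have := hαp t
      have := hγp t
      positivity
    · have hcs : S t ^ 2 ≤ N.card * ∑ j ∈ N, ‖v j t - gradient (f j) (meanIterate x t)‖ ^ 2 :=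
        sq_sum_le_card_mul_sum_sq
      rw [← Finset.mul_sum]
      have hw : 0 ≤ 4 / (n ^ 2 * δ) * (powerSeq cα φ τα t / powerSeq cγ φ τγ t ^ 2) := by
        have := hαp t
        positivity
      have h2 := mul_le_mul_of_nonneg_left hcs hw
      have e : 4 / (n ^ 2 * δ) * (powerSeq cα φ τα t / powerSeq cγ φ τγ t) * S t ^ 2
          / powerSeq cγ φ τγ t
          = 4 / (n ^ 2 * δ) * (powerSeq cα φ τα t / powerSeq cγ φ τγ t ^ 2) * S t ^ 2 := by
        have := (hγp t).ne'
        field_simp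
      rw [e]
      linarith
  -- `K' = 1 / L` is the threshold `γ ≤ L D`. One step moves the average by at most `α γ ≤ γ`,
  -- whence `K = 1 / L + 1`.
  refine exists_bound_of_drift_error (D := fun t => ‖meanIterate x t - xstar‖)
    (a := fun t => δ / 2 * (powerSeq cα φ τα t * powerSeq cγ φ τγ t))
    (K := 1 / L + 1) (K' := 1 / L) hγp (powerSeq_anti hγ.1 hφ hγ0) (fun t => norm_nonneg _)
    (fun t => ?_) (by positivity) (fun t => ?_) hsum ?_ ?_ ?_ ?_ ?_
  · have := hαp t
    have := hγp t
    positivity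
  · have := hαp t
    have := hγp t
    positivity
  · have h0 := tendsto_powerSeq (c := cα) (φ := φ) hα0
    filter_upwards [h0.eventually_le_const (by positivity : 0 < 1 / (δ * L)),
      h0.eventually_le_const (by positivity : 0 < δ / (2 * L))] with t h1 h2 hfar
    rw [le_div_iff₀ (by positivity)] at h1 h2
    refine hp.norm_meanIterate_succ_le hW hO hN hn hαp hγp hδ0 hδn (by linarith) h2 ?_
    rwa [one_div, inv_mul_le_iff₀ hL] at hfar
  · refine Eventually.of_forall fun t hnear => ?_
    have h1 := hp.norm_meanIterate_succ_sub_le hW hn hαp hγp t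
    have h2 := norm_sub_le_norm_sub_add_norm_sub (meanIterate x (t + 1)) (meanIterate x t) xstar
    have h3 := mul_le_mul_of_nonneg_right (hα.2 t).2.le (hγp t).le
    linarith
  · filter_upwards [eventually_powerSeq_slow (c' := 1 / 2) (τ' := 0) hγ.1 one_half_pos hφ hγ0
      zero_lt_one] with t ht
    rw [show powerSeq (1 / 2) φ 0 t = 1 / 2 by simp [powerSeq]] at ht
    linarith
  · intro C
    -- The decrement of `γ` is at most `τγ * γ t / (t + φ)`, which `α t * γ t` dominates because `τα
    -- < 1`.
    filter_upwards [eventually_powerSeq_le (c := C * τγ) (c' := δ / 2 * cα)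
      (mul_pos (by positivity) hα.1) hφ hα1] with t ht
    have h1 := powerSeq_anti hγ.1 hφ hγ0 t.le_succ
    rcases le_total C 0 with hC | hC
    · have h2 : C * (powerSeq cγ φ τγ t - powerSeq cγ φ τγ (t + 1)) ≤ 0 :=
        mul_nonpos_of_nonpos_of_nonneg hC (sub_nonneg.2 h1)
      have := hαp t
      have := hγp t
      exact h2.trans (by positivity)
    · have h2 := mul_le_mul_of_nonneg_left (powerSeq_succ_ge hγ.1 hφ hγ0 t) hC
      rw [← powerSeq_const_mul, ← powerSeq_const_mul] at ht
      have h3 := mul_le_mul_of_nonneg_right ht (hγp t).le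
      linarith
  · rw [summable_mul_left_iff (by positivity)]
    simp only [powerSeq_mul hφ]
    change ¬ Summable (powerSeq (cα * cγ) φ (τα + τγ))
    rw [summable_powerSeq_iff (mul_pos hα.1 hγ.1) hφ]
    linarith

end IsPath

/-! ### From exponent conditions to the almost sure rate. -/

/-- An attacked fraction below `1 / (1 + L / μ)` leaves a positive drift. -/
lemma drift_pos_of_fraction_lt {n : ℕ} {N : Finset (Fin n)} {L μ : ℝ} (hL : 0 < L) (hμ : 0 < μ)
    (hn : 0 < n) (h : (Nᶜ.card : ℝ) / (n : ℝ) < 1 / (1 + L / μ)) :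
    0 < N.card ∧ 0 < N.card * (μ / L) - (Nᶜ.card : ℝ) := by
  have hn' : (0 : ℝ) < n := by exact_mod_cast hn
  have hc : (N.card : ℝ) + Nᶜ.card = n := by
    have := Finset.card_add_card_compl N
    rw [Fintype.card_fin] at this
    exact_mod_cast this
  have h1 : (Nᶜ.card : ℝ) * (1 + L / μ) < n := by
    rw [div_lt_div_iff₀ hn' (by positivity)] at h
    linarith
  have h2 : (Nᶜ.card : ℝ) * (L / μ) < N.card := by linarith
  have h3 : (Nᶜ.card : ℝ) < N.card * (μ / L) := by
    have := mul_lt_mul_of_pos_right h2 (div_pos hμ hL)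
    have e : (Nᶜ.card : ℝ) * (L / μ) * (μ / L) = Nᶜ.card := by field_simp
    linarith
  refine ⟨?_, by linarith⟩
  have h4 : (0 : ℝ) < N.card := lt_of_le_of_lt (by positivity) h2
  exact_mod_cast h4

/-- Sufficient conditions on the exponents for the rate. -/
theorem achievesRate_of_exponents {τα τγ τη : ℝ} (hα0 : 0 < τα) (hα1 : τα < 1) (hγ : 1 / 6 ≤ τγ)
    (hαγ : τα + τγ ≤ 1) (hη0 : 0 ≤ τη) (hη1 : τη < 1) (hτ : 3 * τη ≤ 2 * (τα + τγ))
    (hs : 1 < τα - 2 * τγ + τη) : AchievesRate.{u} τα τγ τη := by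
  intro n d f N L μ xstar G W Ω _ P _ ξ σ cα cγ cη φ x v m hO hW hρ hξ hφ hα hγ' hη hpath i ε
    hε hε'
  have hn : 0 < n := i.pos
  have hL := hO.L_pos
  obtain ⟨hN, hδ⟩ := drift_pos_of_fraction_lt hL hO.μ_pos hn hρ
  have hαp := powerSeq_pos (τ := τα) hα.1 hφ
  have hγp := powerSeq_pos (τ := τγ) hγ'.1 hφ
  have hnoise : ∀ᵐ ω ∂P, ∀ j ∈ N, Summable fun t =>
      powerSeq cα φ τα t / powerSeq cγ φ τγ t ^ 2
        * ‖expFilter (powerSeq cη φ τη) (fun s => ξ j s ω) t‖ ^ 2 := by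
    refine (ae_ball_iff N.countable_toSet).2 fun j hj => ?_
    have hX := hξ.memLp_two j hj
    have hind : Pairwise fun s t => IndepFun (ξ j s) (ξ j t) P := fun s t hst =>
      hξ.independent.indepFun (i := (⟨j, hj⟩, s)) (j := (⟨j, hj⟩, t))
        (fun h => hst (congrArg Prod.snd h))
    obtain ⟨C, hC, hb⟩ := exists_integral_sq_norm_expFilter_le hφ hη hη0 hη1 hX hind
      (hξ.mean_zero j hj) (hξ.second_moment j hj)
    have hw : ∀ t, 0 ≤ powerSeq cα φ τα t / powerSeq cγ φ τγ t ^ 2 := fun t =>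
      div_nonneg (hαp t).le (sq_nonneg _)
    refine ae_summable_of_summable_integral (fun t ω => mul_nonneg (hw t) (sq_nonneg _))
      (fun t => ((memLp_expFilter hX t).integrable_norm_pow two_ne_zero).const_mul _) ?_
    simp only [integral_const_mul]
    have h2 : Summable (powerSeq (C * (cα / (cγ * cγ) * cη)) φ (τα - (τγ + τγ) + τη)) := by
      have := ((summable_powerSeq_iff (φ := φ) (τ := τα - (τγ + τγ) + τη)
        (mul_pos (div_pos hα.1 (mul_pos hγ'.1 hγ'.1)) hη.1) hφ).2 (by linarith)).mul_left C
      exact this.congr fun t => powerSeq_const_mul C t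
    refine Summable.of_nonneg_of_le
      (fun t => mul_nonneg (hw t) (integral_nonneg fun ω => sq_nonneg _)) (fun t => ?_) h2
    refine (mul_le_mul_of_nonneg_left (hb t) (hw t)).trans_eq ?_
    rw [sq, powerSeq_mul hφ, powerSeq_div hφ, mul_left_comm, powerSeq_mul hφ, powerSeq_const_mul]
  filter_upwards [hpath, hnoise] with ω hp hs'
  obtain ⟨C₁, hC₁, h1⟩ := hp.exists_consensus_bound_powerSeq hW hn hφ hα hγ' (by linarith)
  obtain ⟨C₂, h2⟩ := hp.exists_dist_meanIterate_le hW hO hn hN hδ hφ hα hγ' hη hα0 hα1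
    (by linarith) hαγ hη0 hη1 hτ hs hs'
  -- The exponent is positive since `2 * τγ ≥ 1/3`; at `τγ = 1/6` only `ε` keeps it so.
  have hlim : Tendsto (powerSeq (L * (C₁ + C₂) ^ 2 * (cγ * cγ)) φ
      (τγ + τγ + -(1 / 3 - ε))) atTop (𝓝 0) := tendsto_powerSeq (by linarith)
  refine squeeze_zero' (Eventually.of_forall fun t => mul_nonneg (by positivity)
    (hO.avgObjective_sub_nonneg _)) ?_ hlim
  filter_upwards [h2] with t ht
  have hdist : ‖x i t ω - xstar‖ ≤ (C₁ + C₂) * powerSeq cγ φ τγ t := by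
    have h3 := norm_sub_le_norm_sub_add_norm_sub (x i t ω)
      (meanIterate (fun i t => x i t ω) t) xstar
    have h4 := mul_le_mul_of_nonneg_right (hα.2 t).2.le (hγp t).le
    have h5 := mul_le_mul_of_nonneg_left h4 hC₁
    linarith [h1 i t]
  have hobj : avgObjective f N (x i t ω) - avgObjective f N xstar
      ≤ L * (C₁ + C₂) ^ 2 * powerSeq (cγ * cγ) φ (τγ + τγ) t := by
    refine (hO.avgObjective_sub_le hN _).trans ?_
    rw [← powerSeq_mul hφ, mul_assoc, ← sq, ← mul_pow]
    exact mul_le_mul_of_nonneg_left (pow_le_pow_left₀ (norm_nonneg _) hdist 2) hL.le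
  have hbase : ((t : ℝ) + 1) ^ (1 / 3 - ε) ≤ powerSeq 1 φ (-(1 / 3 - ε)) t := by
    have hφ1 : (1 : ℝ) ≤ φ := by exact_mod_cast hφ
    simp only [powerSeq, one_mul, neg_neg]
    exact Real.rpow_le_rpow (by positivity) (by linarith) (by linarith)
  refine (mul_le_mul hbase hobj (hO.avgObjective_sub_nonneg _)
    (powerSeq_pos one_pos hφ t).le).trans_eq ?_
  rw [powerSeq_const_mul, powerSeq_mul hφ, one_mul, add_comm (-(1 / 3 - ε))]

end ClipVRG

end


theorem corollary1 :
    -- some exponents in the open parameter range give the rate, for all `i` and all `ε`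
    (∃ τα τγ τη : ℝ, 0 < τγ ∧ 2 * τγ < τα ∧ τα < min 1 (1 - τγ) ∧ τη = 2 * (τα + τγ) / 3 ∧
      ClipVRG.AchievesRate.{u} τα τγ τη) ∧
    -- so does the choice `(5/6, 1/6)`, on the boundary of that range
    ClipVRG.AchievesRate.{u} (5 / 6) (1 / 6) (2 / 3) ∧
    -- which is the unique maximizer of `min (τγ, (τα - 2 τγ) / 3)` on the closed range
    (∀ a g : ℝ, 2 * g ≤ a → a ≤ min 1 (1 - g) →
      min g ((a - 2 * g) / 3) ≤ 1 / 6 ∧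
      (min g ((a - 2 * g) / 3) = 1 / 6 ↔ a = 5 / 6 ∧ g = 1 / 6)) := by
  -- For `τγ = 1/6` and `τη = 2 (τα + τγ) / 3`, summability of the noise asks for `τα > 11/15` and
  -- the open range for `τα < 5/6`; `4/5` lies between.
  refine ⟨⟨4 / 5, 1 / 6, 29 / 45, by norm_num, by norm_num, by norm_num, by norm_num, ?_⟩, ?_, ?_⟩
  · exact ClipVRG.achievesRate_of_exponents (by norm_num) (by norm_num) (by norm_num)
      (by norm_num) (by norm_num) (by norm_num) (by norm_num) (by norm_num)
  · exact ClipVRG.achievesRate_of_exponents (by norm_num) (by norm_num) (by norm_num)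
      (by norm_num) (by norm_num) (by norm_num) (by norm_num) (by norm_num)
  · intro a g _ h
    obtain ⟨_, h2⟩ := le_min_iff.1 h
    refine ⟨?_, fun he => ?_, ?_⟩
    -- The two terms of the minimum add up to `(a + g) / 3 ≤ 1/3`, so they cannot both exceed `1/6`.
    · rw [min_le_iff]
      by_contra! hc
      linarith [hc.1, hc.2]
    · have h3 := min_le_left g ((a - 2 * g) / 3)
      have h4 := min_le_right g ((a - 2 * g) / 3)
      rw [he] at h3 h4
      constructor <;> linarith
    · rintro ⟨rfl, rfl⟩
      norm_num
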